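/- **Conventions.** For probability measures $P\ll Q$ and $\alpha\ge 0$ let $H_\alpha(P\|Q)=\int \max\{\frac{dP}{dQ}-\alpha,0\}\,dQ$ (hockey stick divergence). For means $\mu\in\mathbb R^{K}$, weights $p\in[0,1]^{K}$ and $\sigma>0$ let $\mathrm{MoG}(\mu,p,\sigma)=\sum_{k=1}^{K}p_k\,\mathcal N(\mu_k,\sigma^2)$ (standard deviation $\sigma$). For an integer $\lambda\ge 1$ and $r\in[0,1]$ let $\mu=(0,2,4,\dots,2\lambda)$ and $p_i=\mathrm{Binomial}(i-1\mid\lambda,r)=\binom{\lambda}{i-1}r^{i-1}(1-r)^{\lambda-i+1}$ for $i=1,\dots,\lambda+1$, and put $$\overline P_r(\lambda)=\mathrm{MoG}(-\mu,p,\sigma),\qquad \overline Q_r(\lambda)=\mathrm{MoG}(\mu,p,\sigma).$$ **Training epoch.** A dataset is a family $x=(x_1,\dots,x_N)$ of time series $x_n\in\mathbb R^{L}$. Write $x\simeq x'$ if $x$ and $x'$ differ in exactly one series, and that series differs in exactly one time step ($1$-event-level neighbors). Fix a context length $L_C$ and a forecast length $L_F$ with $L-L_F+1\ge L_C+L_F$,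 an integer $\Lambda\ge1$ (batch size), a parametric model $f_\theta$ with $\theta\in\mathbb R^D$, a loss $\mathcal L$, a learning rate $\eta\in\mathbb R$, a clipping norm $C>0$, a noise scale $\sigma>0$ and an initial parameter $\theta_0$. One epoch consists of $\lfloor N\lambda/\Lambda\rfloor$ steps. Step $b=1,2,\dots$ uses the series $x_n$ with $(b-1)\lfloor\Lambda/\lambda\rfloor<n\le b\lfloor\Lambda/\lambda\rfloor$ (deterministic top-level iteration). From each of them, after prepending $L_C$ zeros, $\lambda$ contiguous subsequences of length $L_C+L_F$ are drawn independently and uniformly with replacement from the $L-L_F+1$ available starting positions. Each drawn subsequence, split into its first $L_C$ entries $y_C$ and its last $L_F$ entries $y_F$, contributes the clipped gradient $g/\max\{1,\|g\|_2/C\}$, where $g=\nabla_\theta\mathcal L(f_\theta(y_C),y_F)$ at the current $\theta$ (read as $0$ where the loss is not differentiable in $\theta$). If $\hat g$ is the sum of these contributions (with multiplicity), the step releases $\tilde g=\frac1\Lambda\big(\hat g+\mathcal N(0,\sigma^2C^2I)\big)$ and updates $\theta\leftarrow\theta-\eta\tilde g$. Let $M_x$ be the joint law of all noisy gradients $\tilde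 g$ released during the epoch on dataset $x$. **Theorem.** Let $\lambda\ge1$ and $\sigma>0$. 1. For the epoch mechanism $M$ above, with $r=\frac{L_C+L_F}{L-L_F+1}$, the per-epoch privacy profile $H(\alpha)=\sup_{x\simeq x'}H_\alpha(M_x\|M_{x'})$ satisfies, for all $\alpha\ge0$, $$H(\alpha)\le H_\alpha\big(\overline P_r(\lambda)\,\|\,\overline Q_r(\lambda)\big).$$ 2. (Group substitution for sampling with replacement.) Let $\mathbb A$ be a set, $\Delta>0$, and let $f$ map finite multisets over $\mathbb A$ to $\mathbb R^D$ with $\|f(y\cup\{a\})-f(y)\|_2\le\Delta$ for all multisets $y$ and all $a\in\mathbb A$ (multiset union). For a set $x\subseteq\mathbb A$ with $|x|=T\ge1$ let $M_x$ be the law of $f(y)+\mathcal N(0,\sigma^2\Delta^2I)$, where $y$ is the multiset of $\lambda$ elements drawn independently and uniformly with replacement from $x$. If $x,x'\subseteq\mathbb A$ have size $T$ and there are $g\subseteq x$ and $g'\subseteq x'$ with $|g|=|g'|=k$ and $x\setminus g=x'\setminus g'$, then for all $\alpha\ge0$, with $r=k/T$, $$H_\alpha(M_x\|M_{x'})\le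 H_\alpha\big(\overline P_r(\lambda)\,\|\,\overline Q_r(\lambda)\big).$$ -/

import Mathlib

open MeasureTheory ProbabilityTheory
open scoped ENNReal NNReal

noncomputable section

/-- Hockey stick divergence `H_α(P ‖ Q) = ∫ max (dP/dQ - α, 0) dQ`, for `P` absolutely continuous
with respect to `Q`. It is only used for pairs of nondegenerate Gaussian mixtures and for pairs of
output laws that are mutually absolutely continuous. -/
def hockeyStick {Ω : Type*} [MeasurableSpace Ω] (α : ℝ) (P Q : Measure Ω) : ℝ≥0∞ :=
  ∫⁻ o, ENNReal.ofReal ((P.rnDeriv Q o).toReal - α) ∂Q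

/-- The privacy profile `α ↦ sup_{x ≃ x'} H_α(M_x ‖ M_{x'})` of a mechanism, given by the law `M x`
of its output on each dataset `x`. -/
def privacyProfile {X Ω : Type*} [MeasurableSpace Ω] (nbr : X → X → Prop) (M : X → Measure Ω)
    (α : ℝ) : ℝ≥0∞ :=
  ⨆ (x : X) (x' : X) (_ : nbr x x'), hockeyStick α (M x) (M x')

/-- The univariate Gaussian mixture with means `μ`, weights `p` and standard deviation `σ`. -/
def MoG {K : ℕ} (μ p : Fin K → ℝ) (σ : ℝ≥0) : Measure ℝ :=
  ∑ k, ENNReal.ofReal (p k) • gaussianReal (μ k) (σ ^ 2)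

/-- The means `0, 2, 4, …, 2 * lam`. -/
def evenMeans (lam : ℕ) (i : Fin (lam + 1)) : ℝ := 2 * (i : ℝ)

/-- The probabilities `Binomial(i | lam, r)` for `i = 0, …, lam`. -/
def binomialWeights (lam : ℕ) (r : ℝ) (i : Fin (lam + 1)) : ℝ :=
  (lam.choose i : ℝ) * r ^ (i : ℕ) * (1 - r) ^ (lam - (i : ℕ))

/-- The law of the result of drawing `i` uniformly at random from the finite type `ι` and then
drawing from `κ i`. -/
def uniformMixture {ι Ω : Type*} [Fintype ι] [MeasurableSpace Ω] (κ : ι → Measure Ω) :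
    Measure Ω :=
  (Fintype.card ι : ℝ≥0∞)⁻¹ • ∑ i, κ i

/-- The isotropic Gaussian `N(0, s² I)` on `ℝ^D`. -/
def isotropicGaussian (D : ℕ) (s : ℝ≥0) : Measure (EuclideanSpace ℝ (Fin D)) :=
  (stdGaussian (EuclideanSpace ℝ (Fin D))).map (fun z => (s : ℝ) • z)

/-- Two datasets of `N` time series of length `L` are `w`-event-level neighboring if they differ in
exactly one series, and there only inside a window of `w` consecutive time steps. -/
def EventNeighbor {N L : ℕ} (w : ℕ) (x x' : Fin N → Fin L → ℝ) : Prop :=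
  ∃ n, (∀ m, m ≠ n → x m = x' m) ∧ x n ≠ x' n ∧
    ∃ t : Fin L, ∀ s : Fin L, ¬ ((t : ℕ) ≤ s ∧ (s : ℕ) < t + w) → x n s = x' n s

/-- The series `a` with `LC` zeros prepended, as a sequence indexed from `0`
(positions `LC + L` and later, which no subsequence reaches, also carry `0`). -/
def prependZeros {L : ℕ} (LC : ℕ) (a : Fin L → ℝ) (j : ℕ) : ℝ :=
  if h : LC ≤ j ∧ j - LC < L then a ⟨j - LC, h.2⟩ else 0

/-- The context window of the subsequence of length `LC + LF` that starts at position `t` of the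
zero-padded series. -/
def contextWindow {L : ℕ} (LC : ℕ) (a : Fin L → ℝ) (t : ℕ) : Fin LC → ℝ :=
  fun i => prependZeros LC a (t + i)

/-- The forecast window of the subsequence of length `LC + LF` that starts at position `t` of the
zero-padded series. -/
def forecastWindow {L : ℕ} (LC LF : ℕ) (a : Fin L → ℝ) (t : ℕ) : Fin LF → ℝ :=
  fun i => prependZeros LC a (t + LC + i)

/-- Gradient clipping: `g / max {1, ‖g‖ / C}`. -/
def clipGradient {D : ℕ} (C : ℝ≥0) (g : EuclideanSpace ℝ (Fin D)) : EuclideanSpace ℝ (Fin D) :=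
  (max 1 (‖g‖ / C))⁻¹ • g

/-- The clipped gradient, with respect to the parameters, of the loss on the subsequence of the
series `a` that starts at position `t`. -/
def windowGradient {L LC LF D : ℕ} {O : Type*}
    (model : EuclideanSpace ℝ (Fin D) → (Fin LC → ℝ) → O) (loss : O → (Fin LF → ℝ) → ℝ)
    (C : ℝ≥0) (θ : EuclideanSpace ℝ (Fin D)) (a : Fin L → ℝ) (t : ℕ) :
    EuclideanSpace ℝ (Fin D) :=
  clipGradient C
    (gradient (fun ϑ => loss (model ϑ (contextWindow LC a t)) (forecastWindow LC LF a t)) θ)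

/-- Deterministic top-level iteration: the indices of the series used in batch number `b`
(counted from `0`), a block of `⌊Lam / lam⌋` consecutive indices. -/
def topLevelBatch (N lam Lam b : ℕ) : Finset (Fin N) :=
  Finset.univ.filter fun n => b * (Lam / lam) ≤ (n : ℕ) ∧ (n : ℕ) < (b + 1) * (Lam / lam)

/-- The law of the noisy gradient `(1 / Lam) * (ĝ + N(0, σ² C² I))` computed in training step `b`
from parameters `θ`. For every series of the batch, `lam` starting positions are drawn
independently and uniformly, with replacement, from the `L - LF + 1` possible ones, and `ĝ` is the
sum of the clipped gradients of all drawn subsequences, counted with multiplicity. -/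
def noisyGradientLaw {N L LC LF D : ℕ} {O : Type*} (lam Lam : ℕ)
    (model : EuclideanSpace ℝ (Fin D) → (Fin LC → ℝ) → O) (loss : O → (Fin LF → ℝ) → ℝ)
    (σ C : ℝ≥0) (x : Fin N → Fin L → ℝ) (b : ℕ) (θ : EuclideanSpace ℝ (Fin D)) :
    Measure (EuclideanSpace ℝ (Fin D)) :=
  uniformMixture fun start : topLevelBatch N lam Lam b → Fin lam → Fin (L - LF + 1) =>
    (isotropicGaussian D (σ * C)).map fun z =>
      (Lam : ℝ)⁻¹ • ((∑ n : topLevelBatch N lam Lam b, ∑ j,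
        windowGradient model loss C θ (x n) (start n j)) + z)

/-- The joint law of the noisy gradients `g̃_0, …, g̃_{k-1}` released in the first `k` training
steps. Step `k` uses the parameters `θ₀ - η * (g̃_0 + ⋯ + g̃_{k-1})` that result from the
preceding updates `θ ← θ - η * g̃`. -/
def trainingLaw {N L LC LF D : ℕ} {O : Type*} (lam Lam : ℕ)
    (model : EuclideanSpace ℝ (Fin D) → (Fin LC → ℝ) → O) (loss : O → (Fin LF → ℝ) → ℝ)
    (η : ℝ) (σ C : ℝ≥0) (θ₀ : EuclideanSpace ℝ (Fin D)) (x : Fin N → Fin L → ℝ) :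
    (k : ℕ) → Measure (Fin k → EuclideanSpace ℝ (Fin D))
  | 0 => Measure.dirac Fin.elim0
  | k + 1 => (trainingLaw lam Lam model loss η σ C θ₀ x k).bind fun h =>
      (noisyGradientLaw lam Lam model loss σ C x k (θ₀ - η • ∑ i, h i)).map fun g =>
        Fin.snoc (α := fun _ => EuclideanSpace ℝ (Fin D)) h g

/-- The mechanism of one epoch, which consists of `⌊N * lam / Lam⌋` training steps and releases the
noisy gradient of each of them. -/
def epochMechanism {N L LC LF D : ℕ} {O : Type*} (lam Lam : ℕ)
    (model : EuclideanSpace ℝ (Fin D) → (Fin LC → ℝ) → O) (loss : O → (Fin LF → ℝ) → ℝ)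
    (η : ℝ) (σ C : ℝ≥0) (θ₀ : EuclideanSpace ℝ (Fin D)) (x : Fin N → Fin L → ℝ) :
    Measure (Fin (N * lam / Lam) → EuclideanSpace ℝ (Fin D)) :=
  trainingLaw lam Lam model loss η σ C θ₀ x (N * lam / Lam)

/-- `k`-group-substitution neighbors: after removal of a group of `k` elements from each, the two
sets coincide. -/
def GroupSubstitutionNeighbor {A : Type*} [DecidableEq A] (k : ℕ) (x x' : Finset A) : Prop :=
  ∃ g g' : Finset A, g ⊆ x ∧ g' ⊆ x' ∧ g.card = k ∧ g'.card = k ∧ x \ g = x' \ g'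

/-- `f` has `ℓ₂`-sensitivity at most `Δ` under insertion or removal of one batch element. -/
def SensitivityBound {A : Type*} {D : ℕ} (f : Multiset A → EuclideanSpace ℝ (Fin D))
    (Δ : ℝ≥0) : Prop :=
  ∀ (y : Multiset A) (a : A), ‖f (a ::ₘ y) - f y‖ ≤ Δ

/-- The Gaussian mechanism `y ↦ f y + N(0, σ² Δ² I)` applied to a multiset `y` of `lam` elements
drawn independently and uniformly, with replacement, from the set `x`. -/
def withReplacementMechanism {A : Type*} {D : ℕ} (lam : ℕ)
    (f : Multiset A → EuclideanSpace ℝ (Fin D)) (σ Δ : ℝ≥0) (x : Finset A) :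
    Measure (EuclideanSpace ℝ (Fin D)) :=
  uniformMixture fun draw : Fin lam → x =>
    (isotropicGaussian D (σ * Δ)).map fun z =>
      f ((Finset.univ : Finset (Fin lam)).val.map fun j => (draw j : A)) + z

end

/-! A bound `H_α(P ‖ Q) ≤ H` amounts to `∫ φ dP ≤ α ∫ φ dQ + H` for all tests `φ` with values in
`[0, 1]`. This form is stable under mixtures and under kernels, so the proof works with tests
throughout.

Sampling with replacement is decomposed as follows. Each of the `lam` positions receives in advance
one element of the group `G` and one of its complement; then each position independently uses the
former with probability `r`. Let `S` be the set of positions that do. With the advance draws fixed,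
both mechanisms are Gaussian mixtures over `S`. At `S = ∅` their means coincide, in a centre `m`,
and at `S` both lie within `2 * #S * Δ` of `m` (`lintegral_draws_le`).

Given a test, choose the half-line that has the same mass under `N(0, 1)` as the test has under the
Gaussian at `m`. By Neyman–Pearson, shifting by at most `a` raises the test's power at most to that
of the half-line under `N(-a, 1)`, and lowers it at most to that under `N(a, 1)`. One half-line
serves all `S`, from above for `P` and from below for `Q`, so the comparison reduces to this
half-line under the two binomial mixtures (`sum_subsetWeight_lintegral_le`).

In an epoch the batches are disjoint blocks fixed in advance, so the changed series enters at most
one step. Earlier steps have equal laws, and later ones are common kernels, which turn tests into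
tests (`lintegral_trainingLaw_le`). -/

/-! ### Gaussian tests -/

/-- **Neyman–Pearson** for Gaussian location on the line: among all tests `ψ` of a given size under
`N(0, 1)`, a half-line has the largest power under `N(-a, 1)`. -/
theorem lintegral_gaussianReal_neg_le {ψ : ℝ → ℝ≥0∞} (hψ : Measurable ψ) (hψ1 : ∀ x, ψ x ≤ 1)
    {a t : ℝ} (ha : 0 ≤ a) (h : ∫⁻ x, ψ x ∂gaussianReal 0 1 ≤ gaussianReal 0 1 (Set.Iio t)) :
    ∫⁻ x, ψ x ∂gaussianReal (-a) 1 ≤ gaussianReal (-a) 1 (Set.Iio t) := by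
  have hL : ∀ x, gaussianPDFReal (-a) 1 x =
      Real.exp (-a * x - a ^ 2 / 2) * gaussianPDFReal 0 1 x := by
    intro x
    simp only [gaussianPDFReal]
    rw [mul_left_comm, ← Real.exp_add]
    congr 2
    simp only [NNReal.coe_one]
    ring
  set p := gaussianPDF 0 1 with hp
  set q := gaussianPDF (-a) 1 with hq
  have hpm : Measurable p := measurable_gaussianPDF _ _
  have hqm : Measurable q := measurable_gaussianPDF _ _
  -- `κ` is the likelihood ratio at the threshold `t`. The ratio is nonincreasing because `0 ≤ a`,
  -- so `q` dominates `κ * p` on the left of `t` and is dominated on the right.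
  set κ : ℝ≥0∞ := ENNReal.ofReal (Real.exp (-a * t - a ^ 2 / 2))
  have hlow : ∀ x ∈ Set.Iio t, κ * p x ≤ q x := by
    intro x hx
    simp only [κ, hp, hq, gaussianPDF]
    rw [← ENNReal.ofReal_mul (Real.exp_pos _).le, hL x]
    apply ENNReal.ofReal_le_ofReal
    apply mul_le_mul_of_nonneg_right _ (gaussianPDFReal_nonneg _ _ _)
    apply Real.exp_le_exp.2
    have := mul_le_mul_of_nonneg_left (le_of_lt (Set.mem_Iio.1 hx)) ha
    linarith
  have hupp : ∀ x ∈ (Set.Iio t)ᶜ, q x ≤ κ * p x := by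
    intro x hx
    simp only [κ, hp, hq, gaussianPDF]
    rw [← ENNReal.ofReal_mul (Real.exp_pos _).le, hL x]
    apply ENNReal.ofReal_le_ofReal
    apply mul_le_mul_of_nonneg_right _ (gaussianPDFReal_nonneg _ _ _)
    apply Real.exp_le_exp.2
    have := mul_le_mul_of_nonneg_left (not_lt.1 (show ¬ x < t from hx)) ha
    linarith
  rw [gaussianReal_of_var_ne_zero _ one_ne_zero] at h ⊢
  rw [lintegral_withDensity_eq_lintegral_mul _ hpm hψ, withDensity_apply _ measurableSet_Iio] at h
  rw [lintegral_withDensity_eq_lintegral_mul _ hqm hψ, withDensity_apply _ measurableSet_Iio]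
  simp only [Pi.mul_apply] at h ⊢
  have hsplit : ∀ (f : ℝ → ℝ≥0∞) x, f x = f x * ψ x + f x * (1 - ψ x) := by
    intro f x
    rw [← mul_add, add_tsub_cancel_of_le (hψ1 x), mul_one]
  have hsplit' : ∀ f : ℝ → ℝ≥0∞, Measurable f → ∫⁻ x in Set.Iio t, f x =
      (∫⁻ x in Set.Iio t, f x * ψ x) + ∫⁻ x in Set.Iio t, f x * (1 - ψ x) := by
    intro f hf
    rw [← lintegral_add_left (f := fun x => f x * ψ x) (hf.mul hψ)]
    exact lintegral_congr fun x => hsplit f x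
  -- The mass of `ψ` on the half-line occurs on both sides and cancels. What remains compares `ψ`
  -- outside the half-line with `1 - ψ` inside it.
  rw [hsplit' p hpm, ← lintegral_add_compl _ (measurableSet_Iio (a := t))] at h
  rw [hsplit' q hqm, ← lintegral_add_compl _ (measurableSet_Iio (a := t))]
  have hfin : ∫⁻ x in Set.Iio t, p x * ψ x ≠ ∞ := by
    refine ne_top_of_le_ne_top ENNReal.one_ne_top ?_
    rw [← lintegral_gaussianPDF_eq_one 0 (one_ne_zero)]
    exact (setLIntegral_le_lintegral _ _).trans
      (lintegral_mono fun x => mul_le_of_le_one_right' (hψ1 x))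
  have h' := (ENNReal.add_le_add_iff_left hfin).1 h
  refine add_le_add le_rfl ?_
  calc ∫⁻ x in (Set.Iio t)ᶜ, q x * ψ x
      ≤ ∫⁻ x in (Set.Iio t)ᶜ, κ * (p x * ψ x) := by
        refine setLIntegral_mono ((hpm.mul hψ).const_mul κ) fun x hx => ?_
        rw [← mul_assoc]
        gcongr
        exact hupp x hx
    _ = κ * ∫⁻ x in (Set.Iio t)ᶜ, p x * ψ x := lintegral_const_mul _ (hpm.mul hψ)
    _ ≤ κ * ∫⁻ x in Set.Iio t, p x * (1 - ψ x) := by gcongr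
    _ = ∫⁻ x in Set.Iio t, κ * (p x * (1 - ψ x)) :=
        (lintegral_const_mul _ (hpm.mul (measurable_const.sub hψ))).symm
    _ ≤ ∫⁻ x in Set.Iio t, q x * (1 - ψ x) := by
        refine setLIntegral_mono (hqm.mul (measurable_const.sub hψ)) fun x hx => ?_
        rw [← mul_assoc]
        gcongr
        exact hlow x hx

section
variable {E : Type*} [NormedAddCommGroup E] [InnerProductSpace ℝ E] [FiniteDimensional ℝ E]
  [MeasurableSpace E] [BorelSpace E]

/-- The standard Gaussian splits into independent components along a unit vector and orthogonally
to it. -/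
theorem stdGaussian_eq_map_prod {e : E} (he : ‖e‖ = 1) :
    stdGaussian E = ((gaussianReal 0 1).prod (stdGaussian E)).map
      fun p : ℝ × E => p.1 • e + (p.2 - inner ℝ e p.2 • e) := by
  have hm : Measurable fun p : ℝ × E => p.1 • e + (p.2 - inner ℝ e p.2 • e) := by fun_prop
  have : IsProbabilityMeasure (((gaussianReal 0 1).prod (stdGaussian E)).map
      fun p : ℝ × E => p.1 • e + (p.2 - inner ℝ e p.2 • e)) :=
    Measure.isProbabilityMeasure_map hm.aemeasurable
  -- The characteristic function of the right side factors by independence, and Pythagoras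
  -- recombines the exponents.
  apply Measure.ext_of_charFun
  funext t
  have hee : inner ℝ e e = (1 : ℝ) := by rw [real_inner_self_eq_norm_sq, he]; norm_num
  have key : charFun (((gaussianReal 0 1).prod (stdGaussian E)).map
      fun p : ℝ × E => p.1 • e + (p.2 - inner ℝ e p.2 • e)) t =
      charFun (gaussianReal 0 1) (inner ℝ e t) *
        charFun (stdGaussian E) (t - inner ℝ e t • e) := by
    rw [charFun_apply, integral_map hm.aemeasurable (by fun_prop), charFun_apply, charFun_apply,
      ← integral_prod_mul]
    congr 1
    funext p
    rw [← Complex.exp_add, ← add_mul, ← Complex.ofReal_add]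
    congr 3
    simp only [inner_add_left, inner_sub_left, inner_sub_right, real_inner_smul_left,
      real_inner_smul_right, RCLike.inner_apply, conj_trivial]
    rw [real_inner_comm p.2 e]
    ring
  rw [key, charFun_stdGaussian, charFun_stdGaussian, charFun_gaussianReal, ← Complex.exp_add]
  congr 1
  have : ‖t - inner ℝ e t • e‖ ^ 2 = ‖t‖ ^ 2 - inner ℝ e t ^ 2 := by
    rw [← real_inner_self_eq_norm_sq, ← real_inner_self_eq_norm_sq]
    simp only [inner_sub_left, inner_sub_right, real_inner_smul_left, real_inner_smul_right, hee]
    rw [real_inner_comm e t]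
    ring
  have h2 : ((‖t - inner ℝ e t • e‖ : ℝ) : ℂ) ^ 2 = (‖t‖ : ℂ) ^ 2 - ((inner ℝ e t : ℝ) : ℂ) ^ 2 := by
    exact_mod_cast this
  rw [h2]
  push_cast
  ring

theorem gaussianReal_neg_Iio_mono {a b : ℝ} (hab : a ≤ b) (t : ℝ) :
    gaussianReal (-a) 1 (Set.Iio t) ≤ gaussianReal (-b) 1 (Set.Iio t) := by
  have : gaussianReal (-b) 1 = (gaussianReal (-a) 1).map (· + (a - b)) := by
    rw [gaussianReal_map_add_const]
    congr 1
    ring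
  rw [this, Measure.map_apply (by fun_prop) measurableSet_Iio]
  refine measure_mono fun x hx => ?_
  simp only [Set.mem_preimage, Set.mem_Iio] at hx ⊢
  linarith

/-- Averaging `φ` over the directions orthogonal to `v` leaves a test on the line, to which
Neyman–Pearson applies. The axis points along `-v`, so that the shift is `-‖v‖`; a larger shift to
the left only adds mass to the half-line. -/
theorem lintegral_stdGaussian_add_le {φ : E → ℝ≥0∞} (hφ : Measurable φ) (hφ1 : ∀ z, φ z ≤ 1)
    {v : E} {a t : ℝ} (hv : ‖v‖ ≤ a)
    (h : ∫⁻ z, φ z ∂stdGaussian E ≤ gaussianReal 0 1 (Set.Iio t)) :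
    ∫⁻ z, φ (v + z) ∂stdGaussian E ≤ gaussianReal (-a) 1 (Set.Iio t) := by
  refine le_trans ?_ (gaussianReal_neg_Iio_mono hv t)
  rcases eq_or_ne v 0 with rfl | hv0
  · simpa using h
  set e : E := -(‖v‖⁻¹ • v) with he_def
  have hn : ‖v‖ ≠ 0 := norm_ne_zero_iff.2 hv0
  have he : ‖e‖ = 1 := by
    rw [he_def, norm_neg, norm_smul, norm_inv, norm_norm, inv_mul_cancel₀ hn]
  have hve : v = (-‖v‖) • e := by
    rw [he_def, smul_neg, neg_smul, neg_neg, smul_smul, mul_inv_cancel₀ hn, one_smul]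
  set ψ : ℝ → ℝ≥0∞ := fun x => ∫⁻ y, φ (x • e + (y - inner ℝ e y • e)) ∂stdGaussian E with hψ_def
  have hφ2 : Measurable (Function.uncurry fun (x : ℝ) (y : E) =>
      φ (x • e + (y - inner ℝ e y • e))) := by
    apply hφ.comp
    fun_prop
  have hψ : Measurable ψ := hφ2.lintegral_prod_right
  have hψ1 : ∀ x, ψ x ≤ 1 := fun x =>
    (lintegral_mono fun y => hφ1 _).trans (by simp)
  have hshift : ∀ c : ℝ, ∫⁻ z, φ (c • e + z) ∂stdGaussian E = ∫⁻ x, ψ x ∂gaussianReal c 1 := by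
    intro c
    have : gaussianReal c 1 = (gaussianReal 0 1).map (c + ·) := by
      rw [gaussianReal_map_const_add, zero_add]
    rw [this, lintegral_map hψ (by fun_prop)]
    conv_lhs => rw [stdGaussian_eq_map_prod he]
    rw [lintegral_map (by fun_prop) (by fun_prop), lintegral_prod _ (by fun_prop)]
    simp only [hψ_def, add_smul, add_assoc]
  have h0 := hshift 0
  have h1 := hshift (-‖v‖)
  rw [← hve] at h1
  simp only [zero_smul, zero_add] at h0
  rw [h1]
  exact lintegral_gaussianReal_neg_le hψ hψ1 (norm_nonneg v) (h0 ▸ h)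

theorem gaussianReal_Iio_neg (a t : ℝ) :
    gaussianReal (-a) 1 (Set.Iio (-t)) = 1 - gaussianReal a 1 (Set.Iio t) := by
  have hna := nullSingletonClass_gaussianReal (μ := a) (v := 1) one_ne_zero
  rw [← gaussianReal_map_neg, Measure.map_apply (by fun_prop) measurableSet_Iio,
    ← prob_compl_eq_one_sub measurableSet_Iio, Set.compl_Iio]
  have : (fun x : ℝ => -x) ⁻¹' Set.Iio (-t) = Set.Ioi t := by
    ext x; simp
  rw [this]
  exact measure_congr Ioi_ae_eq_Ici

/-- This is the upper bound applied to the complementary test `1 - φ` and the threshold `-t`,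
followed by reflection of the Gaussian. -/
theorem le_lintegral_stdGaussian_add {φ : E → ℝ≥0∞} (hφ : Measurable φ) (hφ1 : ∀ z, φ z ≤ 1)
    {v : E} {a t : ℝ} (hv : ‖v‖ ≤ a)
    (h : gaussianReal 0 1 (Set.Iio t) ≤ ∫⁻ z, φ z ∂stdGaussian E) :
    gaussianReal a 1 (Set.Iio t) ≤ ∫⁻ z, φ (v + z) ∂stdGaussian E := by
  have hcompl : ∀ w : E, ∫⁻ z, (1 - φ (w + z)) ∂stdGaussian E =
      1 - ∫⁻ z, φ (w + z) ∂stdGaussian E := by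
    intro w
    rw [lintegral_sub (by fun_prop) (ne_top_of_le_ne_top ENNReal.one_ne_top
      ((lintegral_mono fun z => hφ1 _).trans (by simp))) (ae_of_all _ fun z => hφ1 _)]
    simp
  have h0 := hcompl 0
  simp only [zero_add] at h0
  have h1 := lintegral_stdGaussian_add_le (φ := fun z => 1 - φ z) (t := -t)
    (measurable_const.sub hφ) (fun z => tsub_le_self) hv (by
      have := gaussianReal_Iio_neg 0 t
      rw [neg_zero] at this
      rw [h0, this]
      exact tsub_le_tsub_left h 1)
  rw [hcompl v, gaussianReal_Iio_neg] at h1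
  exact (ENNReal.sub_le_sub_iff_left prob_le_one ENNReal.one_ne_top).1 h1

/-- Intermediate value theorem for the distribution function, which is continuous as a primitive of
the density. The levels `0` and `1` would need infinite thresholds. -/
theorem exists_gaussianReal_Iio_eq {c : ℝ≥0∞} (h0 : c ≠ 0) (h1 : c < 1) :
    ∃ t : ℝ, gaussianReal 0 1 (Set.Iio t) = c := by
  set μ := gaussianReal 0 1
  have hna : NullSingletonClass μ := nullSingletonClass_gaussianReal one_ne_zero
  have hreal : ∀ t, μ.real (Set.Iic t) = ∫ x in Set.Iic t, gaussianPDFReal 0 1 x := by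
    intro t
    rw [measureReal_def, gaussianReal_apply_eq_integral _ one_ne_zero, ENNReal.toReal_ofReal]
    exact setIntegral_nonneg measurableSet_Iic fun x _ => gaussianPDFReal_nonneg _ _ _
  have hint := integrable_gaussianPDFReal 0 1
  have hcont : Continuous fun t => μ.real (Set.Iic t) := by
    have : (fun t => μ.real (Set.Iic t)) = fun t =>
        (∫ x in Set.Iic (0 : ℝ), gaussianPDFReal 0 1 x) + ∫ x in (0 : ℝ)..t, gaussianPDFReal 0 1 x := by
      funext t
      rw [hreal, ← intervalIntegral.integral_Iic_sub_Iic hint.integrableOn hint.integrableOn]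
      ring
    rw [this]
    exact continuous_const.add
      (intervalIntegral.continuous_primitive (fun _ _ => hint.intervalIntegrable) 0)
  have hbot : Filter.Tendsto (fun t => μ.real (Set.Iic t)) Filter.atBot (nhds 0) := by
    simpa only [← cdf_eq_real] using tendsto_cdf_atBot μ
  have htop : Filter.Tendsto (fun t => μ.real (Set.Iic t)) Filter.atTop (nhds 1) := by
    simpa only [← cdf_eq_real] using tendsto_cdf_atTop μ
  have hct : c ≠ ∞ := ne_top_of_lt h1
  have hc0 : 0 < c.toReal := ENNReal.toReal_pos h0 hct
  have hc1 : c.toReal < 1 := by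
    simpa using (ENNReal.toReal_lt_toReal hct ENNReal.one_ne_top).2 h1
  obtain ⟨t, ht⟩ := mem_range_of_exists_le_of_exists_ge hcont
    ((hbot.eventually (gt_mem_nhds hc0)).exists.imp fun _ h => le_of_lt h)
    ((htop.eventually (lt_mem_nhds hc1)).exists.imp fun _ h => le_of_lt h)
  refine ⟨t, ?_⟩
  rw [measure_congr Iio_ae_eq_Iic, ← ENNReal.toReal_eq_toReal_iff' (measure_ne_top _ _) hct]
  exact ht

end

/-! ### Hockey stick divergence and tests -/

/-- The divergence is attained on the set where `dP/dQ` exceeds `α`. A singular part of `P` can only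
increase `P S`, so absolute continuity plays no role in this direction. -/
theorem hockeyStick_le {Ω : Type*} [MeasurableSpace Ω] {P Q : Measure Ω} [IsFiniteMeasure Q]
    {α : ℝ} (hα : 0 ≤ α) {H : ℝ≥0∞}
    (h : ∀ S, MeasurableSet S → P S ≤ ENNReal.ofReal α * Q S + H) : hockeyStick α P Q ≤ H := by
  set S : Set Ω := {o | α < (P.rnDeriv Q o).toReal}
  have hm : Measurable fun o => (P.rnDeriv Q o).toReal := (Measure.measurable_rnDeriv P Q).ennreal_toReal
  have hS : MeasurableSet S := measurableSet_lt measurable_const hm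
  have h1 : hockeyStick α P Q = ∫⁻ o in S, ENNReal.ofReal ((P.rnDeriv Q o).toReal - α) ∂Q := by
    rw [hockeyStick, ← lintegral_add_compl _ hS]
    rw [setLIntegral_congr_fun (g := fun _ => 0) hS.compl, lintegral_zero, add_zero]
    intro o ho
    have ho' : ¬ α < (P.rnDeriv Q o).toReal := ho
    exact ENNReal.ofReal_of_nonpos (by linarith)
  have hfin : ENNReal.ofReal α * Q S ≠ ∞ := ENNReal.mul_ne_top ENNReal.ofReal_ne_top (measure_ne_top _ _)
  refine (ENNReal.add_le_add_iff_left hfin).1 ?_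
  calc ENNReal.ofReal α * Q S + hockeyStick α P Q
      = ∫⁻ o in S, (ENNReal.ofReal α + ENNReal.ofReal ((P.rnDeriv Q o).toReal - α)) ∂Q := by
        rw [lintegral_add_left measurable_const, h1, setLIntegral_const]
    _ ≤ ∫⁻ o in S, P.rnDeriv Q o ∂Q := by
        refine setLIntegral_mono (Measure.measurable_rnDeriv P Q) fun o ho => ?_
        have ho' : α < (P.rnDeriv Q o).toReal := ho
        rw [← ENNReal.ofReal_add hα (by linarith), add_sub_cancel]
        exact ENNReal.ofReal_toReal_le
    _ ≤ P S := Measure.setLIntegral_rnDeriv_le S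
    _ ≤ _ := h S hS

/-- The converse direction. Absolute continuity ensures that `P S` is recovered from the density. -/
theorem measure_le_add_hockeyStick {Ω : Type*} [MeasurableSpace Ω] {P Q : Measure Ω}
    [SigmaFinite P] [SigmaFinite Q] (hPQ : P ≪ Q) (α : ℝ) (S : Set Ω) :
    P S ≤ ENNReal.ofReal α * Q S + hockeyStick α P Q := by
  calc P S = ∫⁻ o in S, P.rnDeriv Q o ∂Q := (Measure.setLIntegral_rnDeriv hPQ S).symm
    _ ≤ ∫⁻ o in S, (ENNReal.ofReal α + ENNReal.ofReal ((P.rnDeriv Q o).toReal - α)) ∂Q := by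
        refine lintegral_mono_ae (ae_restrict_of_ae ?_)
        filter_upwards [P.rnDeriv_lt_top Q] with o ho
        conv_lhs => rw [← ENNReal.ofReal_toReal ho.ne]
        refine le_trans ?_ ENNReal.ofReal_add_le
        exact ENNReal.ofReal_le_ofReal (by linarith)
    _ = ENNReal.ofReal α * Q S + ∫⁻ o in S, ENNReal.ofReal ((P.rnDeriv Q o).toReal - α) ∂Q := by
        rw [lintegral_add_left measurable_const, setLIntegral_const]
    _ ≤ _ := by
        gcongr
        exact setLIntegral_le_lintegral _ _

/-! ### The dominating pair of Gaussian mixtures -/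

theorem MoG_apply {K : ℕ} (μ p : Fin K → ℝ) (σ : ℝ≥0) (S : Set ℝ) :
    MoG μ p σ S = ∑ k, ENNReal.ofReal (p k) * gaussianReal (μ k) (σ ^ 2) S := by
  simp [MoG]

instance isFiniteMeasure_MoG {K : ℕ} (μ p : Fin K → ℝ) (σ : ℝ≥0) :
    IsFiniteMeasure (MoG μ p σ) := by
  refine ⟨?_⟩
  rw [MoG_apply]
  exact ENNReal.sum_lt_top.2 fun k _ => ENNReal.mul_lt_top ENNReal.ofReal_lt_top (measure_lt_top _ _)

theorem MoG_absolutelyContinuous {K : ℕ} (μ ν p : Fin K → ℝ) {σ : ℝ≥0} (hσ : 0 < σ) :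
    MoG μ p σ ≪ MoG ν p σ := by
  have hv : σ ^ 2 ≠ 0 := (pow_pos hσ 2).ne'
  intro S hS
  rw [MoG_apply, Finset.sum_eq_zero_iff] at hS ⊢
  intro k hk
  rcases mul_eq_zero.1 (hS k hk) with h | h
  · rw [h, zero_mul]
  · rw [((gaussianReal_absolutelyContinuous _ hv).trans
      (gaussianReal_absolutelyContinuous' _ hv)) h, mul_zero]

theorem gaussianReal_Iio_scale (c t : ℝ) {σ : ℝ≥0} (hσ : 0 < σ) :
    gaussianReal c (σ ^ 2) (Set.Iio (σ * t)) = gaussianReal (c / σ) 1 (Set.Iio t) := by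
  have hσ' : (0 : ℝ) < σ := hσ
  have : gaussianReal c (σ ^ 2) = (gaussianReal (c / σ) 1).map ((σ : ℝ) * ·) := by
    rw [gaussianReal_map_const_mul]
    congr 1
    · field_simp
    · ext; simp
  rw [this, Measure.map_apply (by fun_prop) measurableSet_Iio]
  congr 1
  ext x
  simp [mul_lt_mul_iff_right₀ hσ']

/-- The hockey stick divergence of the dominating pair of Gaussian mixtures. -/
noncomputable def dominatingHockeyStick (lam : ℕ) (σ : ℝ≥0) (α r : ℝ) : ℝ≥0∞ :=
  hockeyStick α (MoG (fun i => -1 * evenMeans lam i) (binomialWeights lam r) σ)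
    (MoG (evenMeans lam) (binomialWeights lam r) σ)

/-- The probability `r ^ #S * (1 - r) ^ (lam - #S)` that the successes of `lam` independent trials
with success probability `r` are exactly the ones in `S`. -/
noncomputable def subsetWeight (r : ℝ) {lam : ℕ} (S : Finset (Fin lam)) : ℝ≥0∞ :=
  ENNReal.ofReal r ^ S.card * ENNReal.ofReal (1 - r) ^ (lam - S.card)

theorem sum_subsetWeight_mul_card {r : ℝ} (h0 : 0 ≤ r) (h1 : r ≤ 1) (lam : ℕ) (g : ℕ → ℝ≥0∞) :
    ∑ S : Finset (Fin lam), subsetWeight r S * g S.card =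
      ∑ i : Fin (lam + 1), ENNReal.ofReal (binomialWeights lam r i) * g i := by
  have hS := Finset.sum_powerset_apply_card (x := (Finset.univ : Finset (Fin lam)))
    (fun k => ENNReal.ofReal r ^ k * ENNReal.ofReal (1 - r) ^ (lam - k) * g k)
  rw [Finset.powerset_univ, Finset.card_univ, Fintype.card_fin] at hS
  simp only [subsetWeight]
  rw [hS, Finset.sum_range]
  refine Finset.sum_congr rfl fun i _ => ?_
  have h1' : 0 ≤ 1 - r := by linarith
  rw [binomialWeights, ENNReal.ofReal_mul (by positivity), ENNReal.ofReal_mul (by positivity),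
    ENNReal.ofReal_pow h0, ENNReal.ofReal_pow h1', ENNReal.ofReal_natCast, nsmul_eq_mul]
  ring

theorem sum_subsetWeight {r : ℝ} (h0 : 0 ≤ r) (h1 : r ≤ 1) (lam : ℕ) :
    ∑ S : Finset (Fin lam), subsetWeight r S = 1 := by
  have := Finset.sum_pow_mul_eq_add_pow (ENNReal.ofReal r) (ENNReal.ofReal (1 - r))
    (Finset.univ : Finset (Fin lam))
  rw [← ENNReal.ofReal_add h0 (by linarith), add_sub_cancel, ENNReal.ofReal_one, one_pow,
    Finset.powerset_univ, Finset.card_univ, Fintype.card_fin] at this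
  exact this

theorem MoG_evenMeans_Iio {r : ℝ} (h0 : 0 ≤ r) (h1 : r ≤ 1) (lam : ℕ) {σ : ℝ≥0} (hσ : 0 < σ)
    (c t : ℝ) :
    MoG (fun i => c * evenMeans lam i) (binomialWeights lam r) σ (Set.Iio (σ * t)) =
      ∑ S : Finset (Fin lam), subsetWeight r S *
        gaussianReal (c * (2 * (S.card : ℝ) / σ)) 1 (Set.Iio t) := by
  rw [MoG_apply, sum_subsetWeight_mul_card h0 h1 lam
    fun k => gaussianReal (c * (2 * (k : ℝ) / σ)) 1 (Set.Iio t)]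
  refine Finset.sum_congr rfl fun i _ => ?_
  rw [gaussianReal_Iio_scale _ _ hσ, evenMeans, mul_div_assoc]

/-- The trivial test, constantly one. It settles tests of size one and the epoch without steps. -/
theorem one_le_add_dominatingHockeyStick {r : ℝ} (h0 : 0 ≤ r) (h1 : r ≤ 1) (lam : ℕ) {σ : ℝ≥0}
    (hσ : 0 < σ) (α : ℝ) : 1 ≤ ENNReal.ofReal α + dominatingHockeyStick lam σ α r := by
  have huniv : ∀ μ, MoG μ (binomialWeights lam r) σ Set.univ = 1 := by
    intro μ
    have := sum_subsetWeight_mul_card h0 h1 lam fun _ => 1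
    simp only [mul_one] at this
    rw [MoG_apply]
    simp only [measure_univ, mul_one]
    rw [← this, sum_subsetWeight h0 h1]
  have := measure_le_add_hockeyStick (MoG_absolutelyContinuous
    (fun i => -1 * evenMeans lam i) (evenMeans lam) (binomialWeights lam r) hσ) α Set.univ
  rwa [huniv, huniv, mul_one] at this

instance isProbabilityMeasure_isotropicGaussian (D : ℕ) (s : ℝ≥0) :
    IsProbabilityMeasure (isotropicGaussian D s) :=
  Measure.isProbabilityMeasure_map (by fun_prop)

/-- The Gaussian case of the bound, conditional on the draws: if the means of the Gaussians that
occur with probability `subsetWeight r S` are at distance at most `2 * #S * Δ` from a common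
centre, then the two mixtures are at most as distinguishable as the dominating pair. -/
theorem sum_subsetWeight_lintegral_le {D lam : ℕ} {σ Δ : ℝ≥0} (hσ : 0 < σ) (hΔ : 0 < Δ) (α : ℝ)
    {r : ℝ} (h0 : 0 ≤ r) (h1 : r ≤ 1)
    {φ : EuclideanSpace ℝ (Fin D) → ℝ≥0∞} (hφ : Measurable φ) (hφ1 : ∀ z, φ z ≤ 1)
    (m : EuclideanSpace ℝ (Fin D)) (v w : Finset (Fin lam) → EuclideanSpace ℝ (Fin D))
    (hv : ∀ S, ‖v S - m‖ ≤ 2 * S.card * Δ) (hw : ∀ S, ‖w S - m‖ ≤ 2 * S.card * Δ) :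
    ∑ S, subsetWeight r S * ∫⁻ z, φ (v S + z) ∂isotropicGaussian D (σ * Δ) ≤
      ENNReal.ofReal α *
        ∑ S, subsetWeight r S * ∫⁻ z, φ (w S + z) ∂isotropicGaussian D (σ * Δ) +
      dominatingHockeyStick lam σ α r := by
  have hs : (0 : ℝ) < σ * Δ := mul_pos hσ hΔ
  have hσ' : (0 : ℝ) < σ := hσ
  -- Recentring at `m` and rescaling by `σ * Δ` reduces to standard Gaussians with shifts of norm at
  -- most `2 * #S / σ`.
  set φ' : EuclideanSpace ℝ (Fin D) → ℝ≥0∞ := fun z => φ (m + ((σ : ℝ) * Δ) • z)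
  have hφ' : Measurable φ' := hφ.comp (by fun_prop)
  have hφ1' : ∀ z, φ' z ≤ 1 := fun z => hφ1 _
  have hshift : ∀ u, ∫⁻ z, φ (u + z) ∂isotropicGaussian D (σ * Δ) =
      ∫⁻ z, φ' ((((σ : ℝ) * Δ)⁻¹ • (u - m)) + z) ∂stdGaussian _ := by
    intro u
    rw [isotropicGaussian, lintegral_map (by fun_prop) (by fun_prop)]
    refine lintegral_congr fun z => ?_
    simp only [φ', smul_add, smul_smul, mul_inv_cancel₀ hs.ne', one_smul, NNReal.coe_mul]
    congr 1
    abel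
  have hnorm : ∀ (u : EuclideanSpace ℝ (Fin D)) (S : Finset (Fin lam)),
      ‖u - m‖ ≤ 2 * S.card * Δ → ‖((σ : ℝ) * Δ)⁻¹ • (u - m)‖ ≤ 2 * (S.card : ℝ) / σ := by
    intro u S hu
    have hΔ' : (0 : ℝ) < Δ := hΔ
    rw [norm_smul, norm_inv, Real.norm_of_nonneg hs.le, inv_mul_le_iff₀ hs]
    refine hu.trans (le_of_eq ?_)
    field_simp
  simp only [hshift]
  set c := ∫⁻ z, φ' z ∂stdGaussian (EuclideanSpace ℝ (Fin D)) with hc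
  have hprob : ∀ u, ∫⁻ z, φ' (u + z) ∂stdGaussian (EuclideanSpace ℝ (Fin D)) ≤ 1 := fun u =>
    (lintegral_mono fun z => hφ1' _).trans (by simp)
  have hc1 : c ≤ 1 := by simpa using hprob 0
  have hP1 : ∑ S, subsetWeight r S *
      ∫⁻ z, φ' ((((σ : ℝ) * Δ)⁻¹ • (v S - m)) + z) ∂stdGaussian _ ≤ 1 := by
    rw [← sum_subsetWeight h0 h1 lam]
    exact Finset.sum_le_sum fun S _ => mul_le_of_le_one_right' (hprob _)
  have hH := one_le_add_dominatingHockeyStick h0 h1 lam hσ α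
  have hle : ∀ t, c ≤ gaussianReal 0 1 (Set.Iio t) → ∀ S,
      ∫⁻ z, φ' ((((σ : ℝ) * Δ)⁻¹ • (v S - m)) + z) ∂stdGaussian _ ≤
        gaussianReal (-1 * (2 * (S.card : ℝ) / σ)) 1 (Set.Iio t) := by
    intro t ht S
    rw [neg_one_mul]
    exact lintegral_stdGaussian_add_le hφ' hφ1' (hnorm _ _ (hv S)) ht
  have hge : ∀ t, gaussianReal 0 1 (Set.Iio t) ≤ c → ∀ S,
      gaussianReal (1 * (2 * (S.card : ℝ) / σ)) 1 (Set.Iio t) ≤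
      ∫⁻ z, φ' ((((σ : ℝ) * Δ)⁻¹ • (w S - m)) + z) ∂stdGaussian _ := by
    intro t ht S
    rw [one_mul]
    exact le_lintegral_stdGaussian_add hφ' hφ1' (hnorm _ _ (hw S)) ht
  -- No finite threshold has level `0` or `1`. If `c = 0`, the upper bound holds for every `t`, and
  -- `t → -∞` forces power zero; if `c = 1`, the lower bound with `t → ∞` forces power one.
  rcases eq_or_ne c 0 with hc0 | hc0
  · have hz : ∀ S, ∫⁻ z, φ' ((((σ : ℝ) * Δ)⁻¹ • (v S - m)) + z) ∂stdGaussian _ = 0 := by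
      intro S
      refine le_antisymm ?_ bot_le
      have := ENNReal.tendsto_ofReal (tendsto_cdf_atBot
        (gaussianReal (-1 * (2 * (S.card : ℝ) / σ)) 1))
      simp only [ofReal_cdf, ENNReal.ofReal_zero] at this
      exact ge_of_tendsto this (Filter.Eventually.of_forall fun t =>
          (hle t (hc0 ▸ bot_le) S).trans (measure_mono Set.Iio_subset_Iic_self))
    simp only [hz, mul_zero, Finset.sum_const_zero, zero_le]
  rcases eq_or_lt_of_le hc1 with hc1' | hc1'
  · have hz : ∀ S, ∫⁻ z, φ' ((((σ : ℝ) * Δ)⁻¹ • (w S - m)) + z) ∂stdGaussian _ = 1 := by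
      intro S
      refine le_antisymm (hprob _) ?_
      have hna := nullSingletonClass_gaussianReal
        (μ := 1 * (2 * (S.card : ℝ) / σ)) (v := 1) one_ne_zero
      have := tendsto_measure_Iic_atTop (gaussianReal (1 * (2 * (S.card : ℝ) / σ)) 1)
      rw [measure_univ] at this
      exact le_of_tendsto this
        (Filter.Eventually.of_forall fun t => (measure_congr Iio_ae_eq_Iic).symm.trans_le
          (hge t (hc1' ▸ prob_le_one) S))
    simp only [hz, mul_one, sum_subsetWeight h0 h1]
    exact hP1.trans hH
  · obtain ⟨t, ht⟩ := exists_gaussianReal_Iio_eq hc0 hc1'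
    calc _ ≤ ∑ S : Finset (Fin lam), subsetWeight r S *
          gaussianReal (-1 * (2 * (S.card : ℝ) / σ)) 1 (Set.Iio t) := by
          gcongr with S
          exact hle t ht.ge S
      _ = MoG (fun i => -1 * evenMeans lam i) (binomialWeights lam r) σ (Set.Iio (σ * t)) :=
          (MoG_evenMeans_Iio h0 h1 lam hσ (-1) t).symm
      _ ≤ ENNReal.ofReal α * MoG (evenMeans lam) (binomialWeights lam r) σ (Set.Iio (σ * t)) +
          dominatingHockeyStick lam σ α r :=
          measure_le_add_hockeyStick (MoG_absolutelyContinuous _ _ _ hσ) α _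
      _ ≤ _ := by
          have := MoG_evenMeans_Iio h0 h1 lam hσ 1 t
          simp only [one_mul] at this
          rw [this]
          gcongr with S
          simpa using hge t ht.le S

/-! ### Decomposition of sampling with replacement -/

theorem lintegral_uniformMixture {ι Ω : Type*} [Fintype ι] [MeasurableSpace Ω] (κ : ι → Measure Ω)
    (φ : Ω → ℝ≥0∞) :
    ∫⁻ o, φ o ∂uniformMixture κ = (Fintype.card ι : ℝ≥0∞)⁻¹ * ∑ i, ∫⁻ o, φ o ∂κ i := by
  rw [uniformMixture, lintegral_smul_measure, lintegral_finsetSum_measure, smul_eq_mul]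

theorem isProbabilityMeasure_uniformMixture {ι Ω : Type*} [Fintype ι] [Nonempty ι]
    [MeasurableSpace Ω] (κ : ι → Measure Ω) [∀ i, IsProbabilityMeasure (κ i)] :
    IsProbabilityMeasure (uniformMixture κ) := by
  refine ⟨?_⟩
  have := lintegral_uniformMixture κ fun _ => 1
  simp only [lintegral_one, measure_univ, Finset.sum_const, Finset.card_univ, nsmul_eq_mul,
    mul_one] at this
  rw [this, ENNReal.inv_mul_cancel (by simp) (ENNReal.natCast_ne_top _)]

/-- Change of variables for sums over tuples with independent coordinates. -/
theorem sum_prod_map_mul {κ ι : Type*} [Fintype κ] [Fintype ι] [DecidableEq ι] {n : ℕ}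
    (π : Fin n → κ → ι) (W : Fin n → κ → ℝ≥0∞) (h : (Fin n → ι) → ℝ≥0∞) :
    ∑ d : Fin n → ι, (∏ j, ∑ k, if π j k = d j then W j k else 0) * h d =
      ∑ c : Fin n → κ, (∏ j, W j (c j)) * h fun j => π j (c j) := by
  simp_rw [Finset.prod_univ_sum, Fintype.piFinset_univ, Finset.sum_mul]
  rw [Finset.sum_comm]
  refine Finset.sum_congr rfl fun c _ => ?_
  rw [Finset.sum_eq_single fun j => π j (c j)]
  · simp
  · intro d _ hd
    obtain ⟨j, hj⟩ := Function.ne_iff.1 hd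
    rw [Finset.prod_eq_zero (Finset.mem_univ j) (if_neg fun h => hj h.symm), zero_mul]
  · simp

section
variable {ι : Type*} [DecidableEq ι]

/-- The weights of the uniform distribution on `G`, which is replaced by the point mass at `none` if
`G` is empty. -/
noncomputable def groupWeight (G : Finset ι) (o : Option ι) : ℝ≥0∞ :=
  if G.Nonempty then o.elim 0 fun i => if i ∈ G then (G.card : ℝ≥0∞)⁻¹ else 0
  else o.elim 1 fun _ => 0

theorem groupWeight_some_eq_zero {G : Finset ι} {i : ι} (hi : i ∉ G) :
    groupWeight G (some i) = 0 := by
  simp [groupWeight, hi]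

variable [Fintype ι]

theorem sum_groupWeight (G : Finset ι) : ∑ o, groupWeight G o = 1 := by
  rw [Fintype.sum_option]
  by_cases h : G.Nonempty
  · simp only [groupWeight, if_pos h, Option.elim, zero_add]
    rw [Finset.sum_ite_mem, Finset.univ_inter, Finset.sum_const, nsmul_eq_mul,
      ENNReal.mul_inv_cancel (by simpa using h.ne_empty) (ENNReal.natCast_ne_top _)]
  · simp [groupWeight, if_neg h]

/-- Hitting `G` and then choosing uniformly inside it gives each element of `G` its original
probability. For empty `G` the artificial mass at `none` is killed by the factor zero. -/
theorem card_div_card_mul_groupWeight (G : Finset ι) (o : Option ι) :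
    (G.card : ℝ≥0∞) / Fintype.card ι * groupWeight G o =
      o.elim 0 fun i => if i ∈ G then (Fintype.card ι : ℝ≥0∞)⁻¹ else 0 := by
  by_cases h : G.Nonempty
  · have h0 : (G.card : ℝ≥0∞) ≠ 0 := by simpa using h.ne_empty
    cases o with
    | none => simp [groupWeight, h]
    | some i =>
      simp only [groupWeight, if_pos h, Option.elim]
      split_ifs
      · rw [div_eq_mul_inv, mul_right_comm, ENNReal.mul_inv_cancel h0 (ENNReal.natCast_ne_top _),
          one_mul]
      · rw [mul_zero]
  · rw [Finset.not_nonempty_iff_eq_empty] at h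
    subst h
    cases o <;> simp

/-- Drawing with replacement, split into the set `S` of draws that hit the group `G`, and
independent draws from `G` and from its complement. -/
theorem sum_draws_eq [Nonempty ι] (G : Finset ι) {r : ℝ} (hr : r = G.card / Fintype.card ι)
    {lam : ℕ} (h : (Fin lam → Option ι) → ℝ≥0∞) :
    (Fintype.card (Fin lam → ι) : ℝ≥0∞)⁻¹ * ∑ d : Fin lam → ι, h (fun j => some (d j)) =
      ∑ c : Fin lam → Option ι × Option ι,
        (∏ j, groupWeight G (c j).1 * groupWeight Gᶜ (c j).2) *
          ∑ S : Finset (Fin lam),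
            subsetWeight r S * h fun j => if j ∈ S then (c j).1 else (c j).2 := by
  have hT : (0 : ℝ) < Fintype.card ι := by exact_mod_cast Fintype.card_pos
  have hr0 : ENNReal.ofReal r = (G.card : ℝ≥0∞) / Fintype.card ι := by
    rw [hr, ENNReal.ofReal_div_of_pos hT, ENNReal.ofReal_natCast, ENNReal.ofReal_natCast]
  have hr1 : ENNReal.ofReal (1 - r) = (Gᶜ.card : ℝ≥0∞) / Fintype.card ι := by
    have : 1 - r = (Gᶜ.card : ℝ) / Fintype.card ι := by
      rw [hr, Finset.card_compl, Nat.cast_sub (Finset.card_le_univ _)]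
      field_simp
    rw [this, ENNReal.ofReal_div_of_pos hT, ENNReal.ofReal_natCast, ENNReal.ofReal_natCast]
  -- The law of a single draw, split into hitting and missing `G`.
  have hV : ∀ o : Option ι, (∑ i : ι, if some i = o then (Fintype.card ι : ℝ≥0∞)⁻¹ else 0) =
      ENNReal.ofReal r * groupWeight G o + ENNReal.ofReal (1 - r) * groupWeight Gᶜ o := by
    intro o
    rw [hr0, hr1, card_div_card_mul_groupWeight, card_div_card_mul_groupWeight]
    cases o with
    | none => simp
    | some i =>
      simp only [Option.some.injEq, Option.elim, Finset.sum_ite_eq', Finset.mem_univ, if_true,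
        Finset.mem_compl]
      split_ifs <;> simp_all
  -- For fixed `S` each position uses only one entry of its pair; the weights of the unused entry
  -- sum to one.
  have hW : ∀ (S : Finset (Fin lam)) (j : Fin lam) (o : Option ι),
      (∑ k : Option ι × Option ι, if (if j ∈ S then k.1 else k.2) = o then
        groupWeight G k.1 * groupWeight Gᶜ k.2 else 0) =
      if j ∈ S then groupWeight G o else groupWeight Gᶜ o := by
    intro S j o
    rw [Fintype.sum_prod_type]
    split_ifs with hj
    · simp only
      rw [Finset.sum_eq_single o]
      · simp only [if_true, ← Finset.mul_sum, sum_groupWeight, mul_one]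
      · intro o' _ ho'
        simp [ho']
      · simp
    · simp only
      rw [Finset.sum_comm, Finset.sum_eq_single o]
      · simp only [if_true, ← Finset.sum_mul, sum_groupWeight, one_mul]
      · intro o' _ ho'
        simp [ho']
      · simp
  have h1 := sum_prod_map_mul (fun (_ : Fin lam) (i : ι) => some i)
    (fun _ _ => (Fintype.card ι : ℝ≥0∞)⁻¹) h
  simp only [hV, Finset.prod_const, Finset.card_univ, Fintype.card_fin, ← Finset.mul_sum] at h1
  have hcard : (Fintype.card (Fin lam → ι) : ℝ≥0∞)⁻¹ = (Fintype.card ι : ℝ≥0∞)⁻¹ ^ lam := by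
    rw [Fintype.card_pi_const, Nat.cast_pow, ENNReal.inv_pow]
  rw [hcard, ← h1]
  simp_rw [Finset.mul_sum]
  rw [Finset.sum_comm]
  have h2 : ∀ S : Finset (Fin lam), ∑ c : Fin lam → Option ι × Option ι,
      (∏ j, groupWeight G (c j).1 * groupWeight Gᶜ (c j).2) *
        (subsetWeight r S * h fun j => if j ∈ S then (c j).1 else (c j).2) =
      ∑ d : Fin lam → Option ι, (subsetWeight r S *
        ∏ j, if j ∈ S then groupWeight G (d j) else groupWeight Gᶜ (d j)) * h d := by
    intro S
    have := sum_prod_map_mul (fun (j : Fin lam) (k : Option ι × Option ι) =>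
      if j ∈ S then k.1 else k.2) (fun _ k => groupWeight G k.1 * groupWeight Gᶜ k.2)
      fun d => subsetWeight r S * h d
    simp only [hW] at this
    rw [← this]
    refine Finset.sum_congr rfl fun d _ => ?_
    ring
  rw [Finset.sum_congr rfl fun S _ => h2 S, Finset.sum_comm]
  refine Finset.sum_congr rfl fun d _ => ?_
  -- Expanding the product of the two-term sums of `hV` produces exactly the sum over the hit sets
  -- `S`.
  rw [← Finset.sum_mul, Finset.prod_add, Finset.powerset_univ]
  congr 1
  refine Finset.sum_congr rfl fun S _ => ?_
  rw [Finset.prod_mul_distrib, Finset.prod_mul_distrib, Finset.prod_const, Finset.prod_const,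
    subsetWeight, ← Finset.prod_mul_prod_compl S, ← Finset.compl_eq_univ_sdiff, Finset.card_compl,
    Fintype.card_fin]
  have e1 : ∏ j ∈ S, (if j ∈ S then groupWeight G (d j) else groupWeight Gᶜ (d j)) =
      ∏ j ∈ S, groupWeight G (d j) := Finset.prod_congr rfl fun j hj => if_pos hj
  have e2 : ∏ j ∈ Sᶜ, (if j ∈ S then groupWeight G (d j) else groupWeight Gᶜ (d j)) =
      ∏ j ∈ Sᶜ, groupWeight Gᶜ (d j) :=
    Finset.prod_congr rfl fun j hj => if_neg (Finset.mem_compl.1 hj)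
  rw [e1, e2]
  ring

/-- Sampling with replacement from `ι`: if two functions of the draws agree as long as no draw hits
the group `G`, and if both change by at most `2 * Δ` per substituted draw, then the resulting
Gaussian mechanisms are dominated by the pair of univariate mixtures. The draw `none` contributes
nothing; it takes the place of a draw outside (or inside) of `G` if there is none. -/
theorem lintegral_draws_le [Nonempty ι] (G : Finset ι) {r : ℝ}
    (hr : r = G.card / Fintype.card ι) {D lam : ℕ} {σ Δ : ℝ≥0} (hσ : 0 < σ) (hΔ : 0 < Δ) (α : ℝ)
    {φ : EuclideanSpace ℝ (Fin D) → ℝ≥0∞} (hφ : Measurable φ) (hφ1 : ∀ z, φ z ≤ 1)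
    (F F' : (Fin lam → Option ι) → EuclideanSpace ℝ (Fin D))
    (hFF' : ∀ d, (∀ j, ∀ i ∈ G, d j ≠ some i) → F d = F' d)
    (hF : ∀ d d' (S : Finset (Fin lam)), (∀ j ∉ S, d j = d' j) → ‖F d - F d'‖ ≤ 2 * S.card * Δ)
    (hF' : ∀ d d' (S : Finset (Fin lam)), (∀ j ∉ S, d j = d' j) → ‖F' d - F' d'‖ ≤ 2 * S.card * Δ) :
    (Fintype.card (Fin lam → ι) : ℝ≥0∞)⁻¹ *
        ∑ d : Fin lam → ι, ∫⁻ z, φ (F (fun j => some (d j)) + z) ∂isotropicGaussian D (σ * Δ) ≤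
      ENNReal.ofReal α * ((Fintype.card (Fin lam → ι) : ℝ≥0∞)⁻¹ *
        ∑ d : Fin lam → ι, ∫⁻ z, φ (F' (fun j => some (d j)) + z) ∂isotropicGaussian D (σ * Δ)) +
      dominatingHockeyStick lam σ α r := by
  have hT : (0 : ℝ) < Fintype.card ι := by exact_mod_cast Fintype.card_pos
  have h0 : 0 ≤ r := by rw [hr]; positivity
  have h1 : r ≤ 1 := by
    rw [hr, div_le_one hT]
    exact_mod_cast Finset.card_le_univ _
  rw [sum_draws_eq G hr fun d => ∫⁻ z, φ (F d + z) ∂isotropicGaussian D (σ * Δ),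
    sum_draws_eq G hr fun d => ∫⁻ z, φ (F' d + z) ∂isotropicGaussian D (σ * Δ)]
  set W : (Fin lam → Option ι × Option ι) → ℝ≥0∞ := fun c =>
    ∏ j, groupWeight G (c j).1 * groupWeight Gᶜ (c j).2 with hW
  have hW1 : ∑ c, W c = 1 := by
    have : ∑ k : Option ι × Option ι, groupWeight G k.1 * groupWeight Gᶜ k.2 = 1 := by
      rw [Fintype.sum_prod_type]
      simp only [← Finset.mul_sum, sum_groupWeight, mul_one]
    have h2 := Finset.prod_univ_sum (fun _ : Fin lam => (Finset.univ : Finset (Option ι × Option ι)))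
      fun _ k => groupWeight G k.1 * groupWeight Gᶜ k.2
    simpa [this] using h2.symm
  calc _ ≤ ∑ c, W c * (ENNReal.ofReal α * (∑ S : Finset (Fin lam), subsetWeight r S *
            ∫⁻ z, φ (F' (fun j => if j ∈ S then (c j).1 else (c j).2) + z)
              ∂isotropicGaussian D (σ * Δ)) + dominatingHockeyStick lam σ α r) := by
        refine Finset.sum_le_sum fun c _ => ?_
        rcases eq_or_ne (W c) 0 with hc | hc
        · change W c * _ ≤ _
          rw [hc, zero_mul, zero_mul]
        refine mul_le_mul_right ?_ _
        -- In a tuple of nonzero weight no second entry lies in `G`, so both functions have the same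
        -- value at `S = ∅`. This value is the common centre.
        have hbase : F (fun j => (c j).2) = F' fun j => (c j).2 := by
          refine hFF' _ fun j i hi hj => hc ?_
          refine Finset.prod_eq_zero (Finset.mem_univ j) ?_
          rw [hj, groupWeight_some_eq_zero (by simpa using hi), mul_zero]
        refine sum_subsetWeight_lintegral_le hσ hΔ α h0 h1 hφ hφ1 (F fun j => (c j).2)
          (fun S => F fun j => if j ∈ S then (c j).1 else (c j).2)
          (fun S => F' fun j => if j ∈ S then (c j).1 else (c j).2) ?_ ?_
        · exact fun S => hF _ _ S fun j hj => if_neg hj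
        · rw [hbase]
          exact fun S => hF' _ _ S fun j hj => if_neg hj
    _ = _ := by
        simp only [mul_add, Finset.sum_add_distrib, ← Finset.sum_mul, hW1, one_mul]
        congr 1
        rw [Finset.mul_sum]
        exact Finset.sum_congr rfl fun c _ => mul_left_comm _ _ _

end

/-! ### Group substitution -/

theorem hockeyStick_le_of_lintegral_le {Ω : Type*} [MeasurableSpace Ω] {P Q : Measure Ω}
    [IsFiniteMeasure Q] {α : ℝ} (hα : 0 ≤ α) {H : ℝ≥0∞}
    (h : ∀ φ : Ω → ℝ≥0∞, Measurable φ → (∀ o, φ o ≤ 1) →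
      ∫⁻ o, φ o ∂P ≤ ENNReal.ofReal α * ∫⁻ o, φ o ∂Q + H) : hockeyStick α P Q ≤ H := by
  refine hockeyStick_le hα fun S hS => ?_
  have := h (S.indicator fun _ => 1) (measurable_const.indicator hS) fun o => Set.indicator_le_self _ _ _
  rwa [lintegral_indicator_const hS, lintegral_indicator_const hS, one_mul, one_mul] at this

theorem multiset_filterMap_congr {A B : Type*} {s : Multiset A} {f g : A → Option B}
    (h : ∀ a ∈ s, f a = g a) : s.filterMap f = s.filterMap g := by
  induction s using Quot.inductionOn with
  | h l => exact congrArg _ (List.filterMap_congr h)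

section
variable {A : Type*} {D : ℕ} {f : Multiset A → EuclideanSpace ℝ (Fin D)} {Δ : ℝ≥0}

/-- Substituting one draw is a removal followed by an insertion, each of cost at most `Δ`; a draw
`none` adds no element and costs nothing. -/
theorem SensitivityBound.norm_filterMap_sub_le (hf : SensitivityBound f Δ) {lam : ℕ}
    (S : Finset (Fin lam)) (d d' : Fin lam → Option A) (h : ∀ j ∉ S, d j = d' j) :
    ‖f ((Finset.univ : Finset (Fin lam)).val.filterMap d) -
      f ((Finset.univ : Finset (Fin lam)).val.filterMap d')‖ ≤ 2 * S.card * Δ := by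
  classical
  induction S using Finset.induction_on generalizing d with
  | empty =>
    have : d = d' := funext fun j => h j (Finset.notMem_empty j)
    simp [this]
  | insert i S hi ih =>
    have hins : ∀ (e : Fin lam → Option A),
        ‖f ((Finset.univ : Finset (Fin lam)).val.filterMap e) -
          f (((Finset.univ : Finset (Fin lam)).erase i).val.filterMap e)‖ ≤ Δ := by
      intro e
      have : (Finset.univ : Finset (Fin lam)).val = i ::ₘ ((Finset.univ : Finset (Fin lam)).erase i).val := by
        rw [Finset.erase_val, Multiset.cons_erase (Finset.mem_univ i)]
      rw [this]
      cases he : e i with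
      | none => rw [Multiset.filterMap_cons_none _ _ he]; simp
      | some a => rw [Multiset.filterMap_cons_some _ _ _ he]; exact hf _ _
    have hupd : ((Finset.univ : Finset (Fin lam)).erase i).val.filterMap d =
        ((Finset.univ : Finset (Fin lam)).erase i).val.filterMap (Function.update d i (d' i)) := by
      refine multiset_filterMap_congr fun j hj => ?_
      rw [Function.update_of_ne (Finset.ne_of_mem_erase (s := Finset.univ) hj)]
    have h1 := hins d
    have h2 := hins (Function.update d i (d' i))
    rw [hupd] at h1
    rw [norm_sub_rev] at h2
    have h3 := ih (Function.update d i (d' i)) fun j hj => by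
      by_cases hji : j = i
      · subst hji; simp
      · rw [Function.update_of_ne hji]
        exact h j (by simp [hji, hj])
    rw [Finset.card_insert_of_notMem hi]
    push_cast
    have t1 := norm_sub_le_norm_sub_add_norm_sub
      (f ((Finset.univ : Finset (Fin lam)).val.filterMap d))
      (f (((Finset.univ : Finset (Fin lam)).erase i).val.filterMap (Function.update d i (d' i))))
      (f ((Finset.univ : Finset (Fin lam)).val.filterMap d'))
    have t2 := norm_sub_le_norm_sub_add_norm_sub
      (f (((Finset.univ : Finset (Fin lam)).erase i).val.filterMap (Function.update d i (d' i))))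
      (f ((Finset.univ : Finset (Fin lam)).val.filterMap (Function.update d i (d' i))))
      (f ((Finset.univ : Finset (Fin lam)).val.filterMap d'))
    linarith

/-- Any bijection from `g` to `g'` is extended by the identity. It expresses both mechanisms through
the same draws from `x`. -/
theorem GroupSubstitutionNeighbor.exists_equiv [DecidableEq A] {x x' g g' : Finset A}
    (hg : g ⊆ x) (hg' : g' ⊆ x') (hc : g.card = g'.card) (hd : x \ g = x' \ g') :
    ∃ e : x ≃ x', ∀ a : x, (a : A) ∉ g → (e a : A) = a := by
  let e₀ : g ≃ g' := Finset.equivOfCardEq hc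
  have hmem : ∀ a : A, a ∈ x → a ∉ g → a ∈ x' ∧ a ∉ g' := fun a ha hag =>
    Finset.mem_sdiff.1 (hd ▸ Finset.mem_sdiff.2 ⟨ha, hag⟩)
  let e : x → x' := fun a =>
    if h : (a : A) ∈ g then ⟨e₀ ⟨a, h⟩, hg' (e₀ ⟨a, h⟩).2⟩ else ⟨a, (hmem a a.2 h).1⟩
  have hinj : Function.Injective e := by
    intro a b hab
    simp only [e] at hab
    split_ifs at hab with ha hb hb
    · have h1 : e₀ ⟨a, ha⟩ = e₀ ⟨b, hb⟩ := Subtype.ext (Subtype.mk.inj hab)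
      exact Subtype.ext (Subtype.mk.inj (e₀.injective h1))
    · have h1 : (e₀ ⟨a, ha⟩ : A) = b := congrArg Subtype.val hab
      exact absurd (h1 ▸ (e₀ ⟨a, ha⟩).2) (hmem b b.2 hb).2
    · have h1 : (a : A) = e₀ ⟨b, hb⟩ := congrArg Subtype.val hab
      exact absurd (h1 ▸ (e₀ ⟨b, hb⟩).2) (hmem a a.2 ha).2
    · exact Subtype.ext (Subtype.mk.inj hab)
  have hcard : x.card = x'.card := by
    rw [← Finset.card_sdiff_add_card_eq_card hg, ← Finset.card_sdiff_add_card_eq_card hg', hd, hc]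
  have hbij : Function.Bijective e :=
    (Fintype.bijective_iff_injective_and_card e).2 ⟨hinj, by simpa using hcard⟩
  refine ⟨Equiv.ofBijective e hbij, fun a ha => ?_⟩
  simp [Equiv.ofBijective, e, ha]

theorem lintegral_withReplacementMechanism (lam : ℕ) (f : Multiset A → EuclideanSpace ℝ (Fin D))
    (σ Δ : ℝ≥0) (x : Finset A) {φ : EuclideanSpace ℝ (Fin D) → ℝ≥0∞} (hφ : Measurable φ) :
    ∫⁻ o, φ o ∂withReplacementMechanism lam f σ Δ x =
      (Fintype.card (Fin lam → x) : ℝ≥0∞)⁻¹ * ∑ d : Fin lam → x, ∫⁻ z,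
        φ (f ((Finset.univ : Finset (Fin lam)).val.filterMap fun j => some (d j : A)) + z)
          ∂isotropicGaussian D (σ * Δ) := by
  rw [withReplacementMechanism, lintegral_uniformMixture]
  congr 1
  refine Finset.sum_congr rfl fun d _ => ?_
  rw [lintegral_map hφ (by fun_prop)]
  have : (Finset.univ : Finset (Fin lam)).val.filterMap (fun j => some (d j : A)) =
      (Finset.univ : Finset (Fin lam)).val.map fun j => (d j : A) :=
    congrFun (Multiset.filterMap_eq_map _) _
  rw [this]

/-- Group privacy of the Gaussian mechanism under sampling with replacement and substitution. -/
theorem hockeyStick_withReplacementMechanism_le [DecidableEq A] (hf : SensitivityBound f Δ)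
    (hΔ : 0 < Δ) {σ : ℝ≥0} (hσ : 0 < σ) {α : ℝ} (hα : 0 ≤ α) (lam : ℕ) {x x' : Finset A} {k : ℕ}
    (hx : x.Nonempty) (hx' : x'.card = x.card) (hn : GroupSubstitutionNeighbor k x x') :
    hockeyStick α (withReplacementMechanism lam f σ Δ x) (withReplacementMechanism lam f σ Δ x') ≤
      dominatingHockeyStick lam σ α (k / x.card) := by
  obtain ⟨g, g', hg, hg', hgk, hgk', hd⟩ := hn
  obtain ⟨e, he⟩ := GroupSubstitutionNeighbor.exists_equiv hg hg' (hgk.trans hgk'.symm) hd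
  have : Nonempty x := hx.to_subtype
  have : Nonempty x' := ⟨e this.some⟩
  have : IsProbabilityMeasure (withReplacementMechanism lam f σ Δ x') := by
    have : ∀ d : Fin lam → x', IsProbabilityMeasure ((isotropicGaussian D (σ * Δ)).map fun z =>
        f ((Finset.univ : Finset (Fin lam)).val.map fun j => (d j : A)) + z) := fun d =>
      Measure.isProbabilityMeasure_map (by fun_prop)
    exact isProbabilityMeasure_uniformMixture _
  refine hockeyStick_le_of_lintegral_le hα fun φ hφ hφ1 => ?_
  rw [lintegral_withReplacementMechanism _ _ _ _ _ hφ,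
    lintegral_withReplacementMechanism _ _ _ _ _ hφ]
  set G : Finset x := Finset.univ.filter fun a => (a : A) ∈ g
  have hG : G.card = k := by
    rw [← hgk, ← Finset.card_map (Function.Embedding.subtype _)]
    congr 1
    ext a
    simp only [G, Finset.mem_map, Finset.mem_filter, Finset.mem_univ, true_and,
      Function.Embedding.coe_subtype, Subtype.exists, exists_and_left, exists_prop]
    exact ⟨fun ⟨b, h1, h2, h3⟩ => h3 ▸ h1, fun h => ⟨a, h, hg h, rfl⟩⟩
  have hr : (k / x.card : ℝ) = G.card / Fintype.card x := by rw [hG, Fintype.card_coe]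
  have hsum : ∑ d : Fin lam → x', ∫⁻ z,
        φ (f ((Finset.univ : Finset (Fin lam)).val.filterMap fun j => some (d j : A)) + z)
          ∂isotropicGaussian D (σ * Δ) = ∑ d : Fin lam → x, ∫⁻ z,
        φ (f ((Finset.univ : Finset (Fin lam)).val.filterMap fun j => some (e (d j) : A)) + z)
          ∂isotropicGaussian D (σ * Δ) :=
    ((Equiv.piCongrRight fun _ : Fin lam => e).sum_comp _).symm
  have hcard : Fintype.card (Fin lam → x') = Fintype.card (Fin lam → x) := by
    simp [hx']
  rw [hsum, hcard]
  refine lintegral_draws_le G hr hσ hΔ α hφ hφ1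
    (fun d => f ((Finset.univ : Finset (Fin lam)).val.filterMap fun j => (d j).map fun a => (a : A)))
    (fun d => f ((Finset.univ : Finset (Fin lam)).val.filterMap fun j =>
      (d j).map fun a => (e a : A))) ?_ ?_ ?_
  · intro d hdG
    congr 1
    refine multiset_filterMap_congr fun j _ => ?_
    cases hj : d j with
    | none => rfl
    | some a =>
      have : (a : A) ∉ g := fun h => hdG j a (by simp [G, h]) hj
      simp [he a this]
  · exact fun d d' S h => hf.norm_filterMap_sub_le S _ _ fun j hj => by rw [h j hj]
  · exact fun d d' S h => hf.norm_filterMap_sub_le S _ _ fun j hj => by rw [h j hj]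

end

/-! ### A single training step -/

section
variable {N L LC LF D : ℕ} {O : Type*}
  {model : EuclideanSpace ℝ (Fin D) → (Fin LC → ℝ) → O} {loss : O → (Fin LF → ℝ) → ℝ}

theorem norm_clipGradient_le {C : ℝ≥0} (hC : 0 < C) (g : EuclideanSpace ℝ (Fin D)) :
    ‖clipGradient C g‖ ≤ C := by
  have h1 : (0 : ℝ) < max 1 (‖g‖ / C) := lt_max_of_lt_left one_pos
  rw [clipGradient, norm_smul, norm_inv, Real.norm_of_nonneg h1.le, inv_mul_le_iff₀ h1]
  exact (div_le_iff₀ (NNReal.coe_pos.2 hC)).1 (le_max_right _ _)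

/-- The derivative of an arbitrary function, set to zero where it does not exist, is Borel
measurable in the base point. Hence the model and the loss need no regularity. -/
theorem measurable_windowGradient (C : ℝ≥0) (a : Fin L → ℝ) (t : ℕ) :
    Measurable fun θ => windowGradient model loss C θ a t := by
  unfold windowGradient clipGradient gradient
  have h := measurable_fderiv ℝ
    fun ϑ => loss (model ϑ (contextWindow LC a t)) (forecastWindow LC LF a t)
  have h2 := (InnerProductSpace.toDual ℝ (EuclideanSpace ℝ (Fin D))).symm.continuous.measurable.comp h
  simp only [Function.comp_def] at h2
  exact (measurable_const.max (h2.norm.div_const _)).inv.smul h2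

/-- Subsequences that do not contain the changed time step have the same gradient. -/
theorem windowGradient_congr {a a' : Fin L → ℝ} {t : Fin L}
    (h : ∀ s : Fin L, s ≠ t → a s = a' s) (C : ℝ≥0) (θ : EuclideanSpace ℝ (Fin D)) {s : ℕ}
    (hs : ¬ (s ≤ LC + t ∧ LC + t < s + (LC + LF))) :
    windowGradient model loss C θ a s = windowGradient model loss C θ a' s := by
  -- The padding moves the changed time step `t` to position `LC + t`.
  have hp : ∀ j, j ≠ LC + t → prependZeros LC a j = prependZeros LC a' j := by
    intro j hj
    unfold prependZeros
    split_ifs with hj'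
    · refine h _ fun hjt => hj ?_
      have := congrArg Fin.val hjt
      simp only at this
      omega
    · rfl
  have h1 : contextWindow LC a s = contextWindow LC a' s :=
    funext fun i => hp _ (by have := i.2; omega)
  have h2 : forecastWindow LC LF a s = forecastWindow LC LF a' s :=
    funext fun i => hp _ (by have := i.2; omega)
  rw [windowGradient, windowGradient, h1, h2]

/-- Near the ends of the series fewer than `LC + LF` windows contain the changed step. Enlarging the
group is harmless, since nothing is required of its members, and it yields exactly the rate `r`
without any monotonicity in `r`. -/
theorem exists_affected (hL : LC + LF ≤ L - LF + 1) (t : Fin L) :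
    ∃ G : Finset (Fin (L - LF + 1)), G.card = LC + LF ∧
      ∀ s : Fin (L - LF + 1), s ∉ G → ¬ ((s : ℕ) ≤ LC + t ∧ LC + t < s + (LC + LF)) := by
  set G₀ : Finset (Fin (L - LF + 1)) :=
    Finset.univ.filter fun s => (s : ℕ) ≤ LC + t ∧ LC + t < s + (LC + LF)
  have hG₀ : G₀.card ≤ LC + LF := by
    have hsub : G₀.map Fin.valEmbedding ⊆ Finset.Ico (LC + t + 1 - (LC + LF)) (LC + t + 1) := by
      intro s hs
      obtain ⟨s', hs', rfl⟩ := Finset.mem_map.1 hs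
      have := (Finset.mem_filter.1 hs').2
      simp only [Fin.valEmbedding_apply, Finset.mem_Ico]
      omega
    have := Finset.card_le_card hsub
    rw [Finset.card_map, Nat.card_Ico] at this
    omega
  obtain ⟨G, hG, hc⟩ := Finset.exists_superset_card_eq hG₀ (by simpa using hL)
  exact ⟨G, hc, fun s hs h => hs (hG (by simp [G₀, h]))⟩

theorem card_inv_mul_sum_prod_le {κ₁ κ₂ : Type*} [Fintype κ₁] [Fintype κ₂] [Nonempty κ₂]
    {a a' : κ₁ → κ₂ → ℝ≥0∞} {c H : ℝ≥0∞}
    (h : ∀ k, (Fintype.card κ₁ : ℝ≥0∞)⁻¹ * ∑ i, a i k ≤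
      c * ((Fintype.card κ₁ : ℝ≥0∞)⁻¹ * ∑ i, a' i k) + H) :
    (Fintype.card (κ₁ × κ₂) : ℝ≥0∞)⁻¹ * ∑ p : κ₁ × κ₂, a p.1 p.2 ≤
      c * ((Fintype.card (κ₁ × κ₂) : ℝ≥0∞)⁻¹ * ∑ p : κ₁ × κ₂, a' p.1 p.2) + H := by
  have hsplit : ∀ b : κ₁ → κ₂ → ℝ≥0∞,
      (Fintype.card (κ₁ × κ₂) : ℝ≥0∞)⁻¹ * ∑ p : κ₁ × κ₂, b p.1 p.2 =
        ∑ k, (Fintype.card κ₂ : ℝ≥0∞)⁻¹ * ((Fintype.card κ₁ : ℝ≥0∞)⁻¹ * ∑ i, b i k) := by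
    intro b
    rw [Fintype.card_prod, Nat.cast_mul, ENNReal.mul_inv (Or.inr (ENNReal.natCast_ne_top _))
      (Or.inl (ENNReal.natCast_ne_top _)), Fintype.sum_prod_type, Finset.sum_comm,
      ← Finset.mul_sum, ← Finset.mul_sum]
    ring
  have hone : ∑ _k : κ₂, (Fintype.card κ₂ : ℝ≥0∞)⁻¹ * H = H := by
    rw [Finset.sum_const, Finset.card_univ, nsmul_eq_mul, ← mul_assoc,
      ENNReal.mul_inv_cancel (by simp) (ENNReal.natCast_ne_top _), one_mul]
  rw [hsplit, hsplit]
  calc _ ≤ ∑ k : κ₂, (Fintype.card κ₂ : ℝ≥0∞)⁻¹ *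
        (c * ((Fintype.card κ₁ : ℝ≥0∞)⁻¹ * ∑ i, a' i k) + H) :=
        Finset.sum_le_sum fun k _ => mul_le_mul_right (h k) _
    _ = _ := by
        simp only [mul_add, Finset.sum_add_distrib]
        rw [hone, Finset.mul_sum]
        congr 1
        exact Finset.sum_congr rfl fun k _ => mul_left_comm _ _ _

/-- It suffices to compare averages over one coordinate, with the other coordinates fixed. -/
theorem card_inv_mul_sum_pi_le {B κ : Type*} [Fintype B] [DecidableEq B] [Fintype κ] [Nonempty κ]
    (n : B) {a a' : (B → κ) → ℝ≥0∞} {c H : ℝ≥0∞}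
    (h : ∀ ρ : {m : B // m ≠ n} → κ,
      (Fintype.card κ : ℝ≥0∞)⁻¹ * ∑ k, a ((Equiv.funSplitAt n κ).symm (k, ρ)) ≤
        c * ((Fintype.card κ : ℝ≥0∞)⁻¹ * ∑ k, a' ((Equiv.funSplitAt n κ).symm (k, ρ))) + H) :
    (Fintype.card (B → κ) : ℝ≥0∞)⁻¹ * ∑ s, a s ≤
      c * ((Fintype.card (B → κ) : ℝ≥0∞)⁻¹ * ∑ s, a' s) + H := by
  rw [← (Equiv.funSplitAt n κ).symm.sum_comp a, ← (Equiv.funSplitAt n κ).symm.sum_comp a',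
    Fintype.card_congr (Equiv.funSplitAt n κ)]
  exact card_inv_mul_sum_prod_le (a := fun k ρ => a ((Equiv.funSplitAt n κ).symm (k, ρ)))
    (a' := fun k ρ => a' ((Equiv.funSplitAt n κ).symm (k, ρ))) h

theorem norm_sum_sub_sum_le {lam : ℕ} {E : Type*} [SeminormedAddCommGroup E] {C : ℝ}
    (u v : Fin lam → E) (hu : ∀ j, ‖u j‖ ≤ C) (hv : ∀ j, ‖v j‖ ≤ C)
    (S : Finset (Fin lam)) (h : ∀ j ∉ S, u j = v j) :
    ‖∑ j, u j - ∑ j, v j‖ ≤ 2 * S.card * C := by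
  rw [← Finset.sum_sub_distrib, ← Finset.sum_subset (Finset.subset_univ S)
    fun j _ hj => sub_eq_zero.2 (h j hj)]
  refine (norm_sum_le_of_le S (f := fun j => u j - v j) (n := fun _ => C + C) fun j _ =>
    (norm_sub_le _ _).trans (add_le_add (hu j) (hv j))).trans (le_of_eq ?_)
  rw [Finset.sum_const, nsmul_eq_mul]
  ring

theorem lintegral_noisyGradientLaw (lam Lam : ℕ) (σ C : ℝ≥0) (x : Fin N → Fin L → ℝ) (b : ℕ)
    (θ : EuclideanSpace ℝ (Fin D)) {φ : EuclideanSpace ℝ (Fin D) → ℝ≥0∞} (hφ : Measurable φ) :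
    ∫⁻ o, φ o ∂noisyGradientLaw lam Lam model loss σ C x b θ =
      (Fintype.card (topLevelBatch N lam Lam b → Fin lam → Fin (L - LF + 1)) : ℝ≥0∞)⁻¹ *
        ∑ start : topLevelBatch N lam Lam b → Fin lam → Fin (L - LF + 1),
          ∫⁻ z, φ ((Lam : ℝ)⁻¹ • ((∑ n : topLevelBatch N lam Lam b, ∑ j,
            windowGradient model loss C θ (x n) (start n j)) + z)) ∂isotropicGaussian D (σ * C) := by
  rw [noisyGradientLaw, lintegral_uniformMixture]
  congr 1
  refine Finset.sum_congr rfl fun d _ => ?_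
  rw [lintegral_map hφ (by fun_prop)]

/-- The noisy gradients of the training step that uses the changed series. -/
theorem lintegral_noisyGradientLaw_le (hL : LC + LF ≤ L - LF + 1) (lam Lam : ℕ) {σ C : ℝ≥0}
    (hσ : 0 < σ) (hC : 0 < C) (α : ℝ) {x x' : Fin N → Fin L → ℝ} {n : Fin N}
    (hx : ∀ m, m ≠ n → x m = x' m) {t : Fin L} (ht : ∀ s : Fin L, s ≠ t → x n s = x' n s)
    {b : ℕ} (hb : n ∈ topLevelBatch N lam Lam b) (θ : EuclideanSpace ℝ (Fin D))
    {φ : EuclideanSpace ℝ (Fin D) → ℝ≥0∞} (hφ : Measurable φ) (hφ1 : ∀ z, φ z ≤ 1) :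
    ∫⁻ o, φ o ∂noisyGradientLaw lam Lam model loss σ C x b θ ≤
      ENNReal.ofReal α * ∫⁻ o, φ o ∂noisyGradientLaw lam Lam model loss σ C x' b θ +
        dominatingHockeyStick lam σ α (((LC + LF : ℕ) : ℝ) / ((L - LF + 1 : ℕ) : ℝ)) := by
  obtain ⟨G, hG, hGs⟩ := exists_affected hL t
  have hr : (((LC + LF : ℕ) : ℝ) / ((L - LF + 1 : ℕ) : ℝ)) =
      G.card / Fintype.card (Fin (L - LF + 1)) := by rw [hG, Fintype.card_fin]
  rw [lintegral_noisyGradientLaw _ _ _ _ _ _ _ hφ, lintegral_noisyGradientLaw _ _ _ _ _ _ _ hφ]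
  set B := topLevelBatch N lam Lam b
  let n' : B := ⟨n, hb⟩
  -- The contribution of the other series, with their draws held fixed. It is the same for `x` and
  -- `x'` and only translates the Gaussians.
  let rest : ({m : B // m ≠ n'} → Fin lam → Fin (L - LF + 1)) → EuclideanSpace ℝ (Fin D) := fun ρ =>
    ∑ m : {m : B // m ≠ n'}, ∑ j, windowGradient model loss C θ (x m.1) (ρ m j)
  have hne : ∀ m : {m : B // m ≠ n'}, (m.1 : Fin N) ≠ n := fun m h => m.2 (Subtype.ext h)
  have hrest : ∀ ρ : {m : B // m ≠ n'} → Fin lam → Fin (L - LF + 1),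
      ∑ m : {m : B // m ≠ n'}, ∑ j, windowGradient model loss C θ (x' m.1) (ρ m j) = rest ρ := by
    intro ρ
    refine Finset.sum_congr rfl fun m _ => ?_
    rw [hx _ (hne m)]
  have hsplit : ∀ (y : Fin N → Fin L → ℝ) (d : Fin lam → Fin (L - LF + 1))
      (ρ : {m : B // m ≠ n'} → Fin lam → Fin (L - LF + 1)),
      ∑ m : B, ∑ j, windowGradient model loss C θ (y m)
          ((Equiv.funSplitAt n' (Fin lam → Fin (L - LF + 1))).symm (d, ρ) m j) =
        ∑ j, windowGradient model loss C θ (y n) (d j) +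
          ∑ m : {m : B // m ≠ n'}, ∑ j, windowGradient model loss C θ (y m.1) (ρ m j) := by
    intro y d ρ
    rw [Fintype.sum_eq_add_sum_subtype_ne _ n']
    congr 1
    · refine Finset.sum_congr rfl fun j _ => ?_
      simp [n']
    · refine Finset.sum_congr rfl fun m _ => Finset.sum_congr rfl fun j _ => ?_
      simp [m.2]
  refine card_inv_mul_sum_pi_le n' fun ρ => ?_
  simp only [hsplit, hrest]
  have hw : ∀ (a : Fin L → ℝ) (o : Option (Fin (L - LF + 1))),
      ‖o.elim 0 fun s => windowGradient model loss C θ a s‖ ≤ C := by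
    intro a o
    cases o with
    | none => simp
    | some s => exact norm_clipGradient_le hC _
  have hlip : ∀ (a : Fin L → ℝ) (d d' : Fin lam → Option (Fin (L - LF + 1)))
      (S : Finset (Fin lam)), (∀ j ∉ S, d j = d' j) →
      ‖(∑ j, (d j).elim 0 (fun s => windowGradient model loss C θ a s) + rest ρ) -
        (∑ j, (d' j).elim 0 (fun s => windowGradient model loss C θ a s) + rest ρ)‖ ≤
          2 * S.card * C := by
    intro a d d' S h
    rw [add_sub_add_right_eq_sub]
    exact norm_sum_sub_sum_le _ _ (fun j => hw a _) (fun j => hw a _) S fun j hj => by rw [h j hj]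
  -- The factor `1 / Lam` is postprocessing and is absorbed into the test.
  refine lintegral_draws_le (φ := fun u => φ ((Lam : ℝ)⁻¹ • u)) G hr hσ hC α
    (hφ.comp (by fun_prop)) (fun z => hφ1 _)
    (fun d => ∑ j, (d j).elim 0 (fun s => windowGradient model loss C θ (x n) s) + rest ρ)
    (fun d => ∑ j, (d j).elim 0 (fun s => windowGradient model loss C θ (x' n) s) + rest ρ)
    ?_ (hlip _) (hlip _)
  intro d hd
  congr 1
  refine Finset.sum_congr rfl fun j _ => ?_
  cases hj : d j with
  | none => rfl
  | some s => exact windowGradient_congr ht C θ (hGs s fun hs => hd j s hs hj)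

end

/-! ### Composition over the epoch -/

section
variable {N L LC LF D : ℕ} {O : Type*}
  {model : EuclideanSpace ℝ (Fin D) → (Fin LC → ℝ) → O} {loss : O → (Fin LF → ℝ) → ℝ}

instance isProbabilityMeasure_noisyGradientLaw (lam Lam : ℕ) (σ C : ℝ≥0) (x : Fin N → Fin L → ℝ)
    (b : ℕ) (θ : EuclideanSpace ℝ (Fin D)) :
    IsProbabilityMeasure (noisyGradientLaw lam Lam model loss σ C x b θ) := by
  have : ∀ start : topLevelBatch N lam Lam b → Fin lam → Fin (L - LF + 1),
      IsProbabilityMeasure ((isotropicGaussian D (σ * C)).map fun z =>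
        (Lam : ℝ)⁻¹ • ((∑ n : topLevelBatch N lam Lam b, ∑ j,
          windowGradient model loss C θ (x n) (start n j)) + z)) := fun start =>
    Measure.isProbabilityMeasure_map (by fun_prop)
  exact isProbabilityMeasure_uniformMixture _

theorem measurable_noisyGradientLaw (lam Lam : ℕ) (σ C : ℝ≥0) (x : Fin N → Fin L → ℝ) (b : ℕ) :
    Measurable (noisyGradientLaw lam Lam model loss σ C x b) := by
  refine Measure.measurable_of_measurable_coe _ fun S hS => ?_
  have h : ∀ θ, noisyGradientLaw lam Lam model loss σ C x b θ S =
      (Fintype.card (topLevelBatch N lam Lam b → Fin lam → Fin (L - LF + 1)) : ℝ≥0∞)⁻¹ *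
        ∑ start : topLevelBatch N lam Lam b → Fin lam → Fin (L - LF + 1),
          ∫⁻ z, S.indicator (fun _ => 1) ((Lam : ℝ)⁻¹ • ((∑ n : topLevelBatch N lam Lam b, ∑ j,
            windowGradient model loss C θ (x n) (start n j)) + z)) ∂isotropicGaussian D (σ * C) := by
    intro θ
    rw [← lintegral_noisyGradientLaw _ _ _ _ _ _ _ (measurable_const.indicator hS),
      lintegral_indicator_const hS, one_mul]
  simp only [h]
  refine (Finset.measurable_sum _ fun start _ => ?_).const_mul _
  refine Measurable.lintegral_prod_right' (f := fun p : EuclideanSpace ℝ (Fin D) × _ =>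
    S.indicator (fun _ => (1 : ℝ≥0∞)) ((Lam : ℝ)⁻¹ • ((∑ n : topLevelBatch N lam Lam b, ∑ j,
            windowGradient model loss C p.1 (x n) (start n j)) + p.2))) ?_
  have hg : Measurable fun p : EuclideanSpace ℝ (Fin D) × EuclideanSpace ℝ (Fin D) =>
      ∑ n : topLevelBatch N lam Lam b, ∑ j,
        windowGradient model loss C p.1 (x n) (start n j) :=
    Finset.measurable_sum _ fun n _ => Finset.measurable_sum _ fun j _ =>
      (measurable_windowGradient C (x n) _).comp measurable_fst
  exact (measurable_const.indicator hS).comp ((hg.add measurable_snd).const_smul (Lam : ℝ)⁻¹)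

theorem measurable_snoc {E : Type*} [MeasurableSpace E] (k : ℕ) :
    Measurable fun p : (Fin k → E) × E => (Fin.snoc (α := fun _ => E) p.1 p.2 : Fin (k + 1) → E) := by
  refine measurable_pi_lambda _ fun i => ?_
  refine Fin.lastCases ?_ (fun i => ?_) i
  · simpa using measurable_snd
  · simpa [Function.comp_def] using (measurable_pi_apply i).comp measurable_fst

variable (lam Lam : ℕ) (η : ℝ) (σ C : ℝ≥0) (θ₀ : EuclideanSpace ℝ (Fin D))

/-- The Markov kernel from the first `k` noisy gradients to the next one. -/
noncomputable def stepKernel (model : EuclideanSpace ℝ (Fin D) → (Fin LC → ℝ) → O)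
    (loss : O → (Fin LF → ℝ) → ℝ) (x : Fin N → Fin L → ℝ) (k : ℕ) :
    Kernel (Fin k → EuclideanSpace ℝ (Fin D)) (EuclideanSpace ℝ (Fin D)) where
  toFun h := noisyGradientLaw lam Lam model loss σ C x k (θ₀ - η • ∑ i, h i)
  measurable' := (measurable_noisyGradientLaw lam Lam σ C x k).comp (by fun_prop)

instance isMarkovKernel_stepKernel (x : Fin N → Fin L → ℝ) (k : ℕ) :
    IsMarkovKernel (stepKernel lam Lam η σ C θ₀ model loss x k) :=
  ⟨fun _ => isProbabilityMeasure_noisyGradientLaw _ _ _ _ _ _ _⟩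

theorem measurable_lintegral_stepKernel (x : Fin N → Fin L → ℝ) (k : ℕ)
    {φ : (Fin (k + 1) → EuclideanSpace ℝ (Fin D)) → ℝ≥0∞} (hφ : Measurable φ) :
    Measurable fun h => ∫⁻ g, φ (Fin.snoc (α := fun _ => EuclideanSpace ℝ (Fin D)) h g)
      ∂stepKernel lam Lam η σ C θ₀ model loss x k h :=
  Measurable.lintegral_kernel_prod_right
    (f := fun h g => φ (Fin.snoc (α := fun _ => EuclideanSpace ℝ (Fin D)) h g))
    (hφ.comp (measurable_snoc k))

theorem trainingLaw_succ_kernel (x : Fin N → Fin L → ℝ) (k : ℕ) :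
    trainingLaw lam Lam model loss η σ C θ₀ x (k + 1) =
      (trainingLaw lam Lam model loss η σ C θ₀ x k).bind fun h =>
        (stepKernel lam Lam η σ C θ₀ model loss x k h).map fun g =>
          Fin.snoc (α := fun _ => EuclideanSpace ℝ (Fin D)) h g := rfl

theorem lintegral_trainingLaw_succ (x : Fin N → Fin L → ℝ) (k : ℕ)
    {φ : (Fin (k + 1) → EuclideanSpace ℝ (Fin D)) → ℝ≥0∞} (hφ : Measurable φ) :
    ∫⁻ o, φ o ∂trainingLaw lam Lam model loss η σ C θ₀ x (k + 1) =
      ∫⁻ h, ∫⁻ g, φ (Fin.snoc (α := fun _ => EuclideanSpace ℝ (Fin D)) h g)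
        ∂stepKernel lam Lam η σ C θ₀ model loss x k h
        ∂trainingLaw lam Lam model loss η σ C θ₀ x k := by
  have hsnoc : ∀ h : Fin k → EuclideanSpace ℝ (Fin D), Measurable fun g =>
      (Fin.snoc (α := fun _ => EuclideanSpace ℝ (Fin D)) h g : Fin (k + 1) → _) := fun h =>
    (measurable_snoc k).comp measurable_prodMk_left
  have hm : Measurable fun h => (stepKernel lam Lam η σ C θ₀ model loss x k h).map fun g =>
      (Fin.snoc (α := fun _ => EuclideanSpace ℝ (Fin D)) h g : Fin (k + 1) → _) := by
    refine Measure.measurable_of_measurable_coe _ fun S hS => ?_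
    have := measurable_lintegral_stepKernel (model := model) (loss := loss) lam Lam η σ C θ₀ x k
      ((measurable_const (a := (1 : ℝ≥0∞))).indicator hS)
    convert this using 2 with h
    rw [← lintegral_map (measurable_const.indicator hS) (hsnoc h), lintegral_indicator_const hS,
      one_mul]
  rw [trainingLaw_succ_kernel, Measure.lintegral_bind hm.aemeasurable hφ.aemeasurable]
  exact lintegral_congr fun h => lintegral_map hφ (hsnoc h)

instance isProbabilityMeasure_trainingLaw (x : Fin N → Fin L → ℝ) (k : ℕ) :
    IsProbabilityMeasure (trainingLaw lam Lam model loss η σ C θ₀ x k) := by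
  induction k with
  | zero => exact Measure.dirac.isProbabilityMeasure
  | succ k ih =>
    refine ⟨?_⟩
    have := lintegral_trainingLaw_succ (model := model) (loss := loss) lam Lam η σ C θ₀ x k
      (φ := fun _ => 1) measurable_const
    simpa using this

theorem noisyGradientLaw_congr {x x' : Fin N → Fin L → ℝ} {n : Fin N}
    (hx : ∀ m, m ≠ n → x m = x' m) {b : ℕ} (hb : n ∉ topLevelBatch N lam Lam b) :
    noisyGradientLaw lam Lam model loss σ C x b = noisyGradientLaw lam Lam model loss σ C x' b := by
  have : ∀ m : topLevelBatch N lam Lam b, x m = x' m := fun m => hx m fun h => hb (h ▸ m.2)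
  funext θ
  simp only [noisyGradientLaw, this]

theorem notMem_topLevelBatch_of_lt {n : Fin N} {b k : ℕ} (hk : n ∈ topLevelBatch N lam Lam k)
    (hb : b < k) : n ∉ topLevelBatch N lam Lam b := by
  intro h
  have h1 := (Finset.mem_filter.1 hk).2.1
  have h2 := (Finset.mem_filter.1 h).2.2
  have h3 : (b + 1) * (Lam / lam) ≤ k * (Lam / lam) := Nat.mul_le_mul_right _ hb
  omega

theorem trainingLaw_congr {x x' : Fin N → Fin L → ℝ} {n : Fin N}
    (hx : ∀ m, m ≠ n → x m = x' m) {k : ℕ} (hk : ∀ b < k, n ∉ topLevelBatch N lam Lam b) :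
    trainingLaw lam Lam model loss η σ C θ₀ x k = trainingLaw lam Lam model loss η σ C θ₀ x' k := by
  induction k with
  | zero => rfl
  | succ k ih =>
    rw [trainingLaw, trainingLaw, ih fun b hb => hk b (hb.trans k.lt_succ_self),
      noisyGradientLaw_congr lam Lam σ C hx (hk k k.lt_succ_self)]

/-- Adaptive composition: the changed series influences at most one training step. -/
theorem lintegral_trainingLaw_le (hL : LC + LF ≤ L - LF + 1) {σ C : ℝ≥0}
    (hσ : 0 < σ) (hC : 0 < C) (α : ℝ) {x x' : Fin N → Fin L → ℝ} {n : Fin N}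
    (hx : ∀ m, m ≠ n → x m = x' m) {t : Fin L} (ht : ∀ s : Fin L, s ≠ t → x n s = x' n s) (k : ℕ)
    {φ : (Fin k → EuclideanSpace ℝ (Fin D)) → ℝ≥0∞} (hφ : Measurable φ) (hφ1 : ∀ z, φ z ≤ 1) :
    ∫⁻ o, φ o ∂trainingLaw lam Lam model loss η σ C θ₀ x k ≤
      ENNReal.ofReal α * ∫⁻ o, φ o ∂trainingLaw lam Lam model loss η σ C θ₀ x' k +
        dominatingHockeyStick lam σ α (((LC + LF : ℕ) : ℝ) / ((L - LF + 1 : ℕ) : ℝ)) := by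
  set r : ℝ := ((LC + LF : ℕ) : ℝ) / ((L - LF + 1 : ℕ) : ℝ)
  induction k with
  | zero =>
    have h0 : 0 ≤ r := by positivity
    have h1 : r ≤ 1 := by
      rw [div_le_one (by positivity)]
      exact_mod_cast hL
    have hH := one_le_add_dominatingHockeyStick h0 h1 lam hσ α
    rw [trainingLaw, trainingLaw]
    set c := ∫⁻ o, φ o ∂Measure.dirac Fin.elim0
    have hc : c ≤ 1 := (lintegral_mono fun o => hφ1 o).trans (by simp)
    -- Without steps both laws are the same point mass, and `1 ≤ α + H` together with `c ≤ 1`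
    -- suffices.
    calc c ≤ c * (ENNReal.ofReal α + dominatingHockeyStick lam σ α r) := le_mul_of_one_le_right' hH
      _ = ENNReal.ofReal α * c + c * dominatingHockeyStick lam σ α r := by ring
      _ ≤ _ := by
        gcongr
        exact mul_le_of_le_one_left' hc
  | succ k ih =>
    rw [lintegral_trainingLaw_succ _ _ _ _ _ _ _ _ hφ, lintegral_trainingLaw_succ _ _ _ _ _ _ _ _ hφ]
    by_cases hk : n ∈ topLevelBatch N lam Lam k
    -- If step `k` uses the changed series, no earlier step does. The histories have equal laws, and
    -- the one-step bound is integrated over them.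
    · rw [trainingLaw_congr lam Lam η σ C θ₀ hx fun b hb => notMem_topLevelBatch_of_lt lam Lam hk hb]
      calc _ ≤ ∫⁻ h, (ENNReal.ofReal α *
            ∫⁻ g, φ (Fin.snoc (α := fun _ => EuclideanSpace ℝ (Fin D)) h g)
              ∂stepKernel lam Lam η σ C θ₀ model loss x' k h + dominatingHockeyStick lam σ α r)
              ∂trainingLaw lam Lam model loss η σ C θ₀ x' k :=
            lintegral_mono fun h => lintegral_noisyGradientLaw_le hL lam Lam hσ hC α hx ht hk _
              (hφ.comp ((measurable_snoc k).comp measurable_prodMk_left)) fun _ => hφ1 _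
        _ = _ := by
            rw [lintegral_add_right _ measurable_const, lintegral_const, measure_univ, mul_one,
              lintegral_const_mul' _ _ ENNReal.ofReal_ne_top]
    -- Otherwise both datasets give the same kernel in step `k`, and integrating out the last
    -- gradient leaves a test on the first `k`.
    · have hker : stepKernel lam Lam η σ C θ₀ model loss x k =
          stepKernel lam Lam η σ C θ₀ model loss x' k := by
        ext1 h
        exact congrFun (noisyGradientLaw_congr lam Lam σ C hx hk) _
      rw [hker]
      refine ih (measurable_lintegral_stepKernel lam Lam η σ C θ₀ x' k hφ) fun h => ?_
      exact (lintegral_mono fun g => hφ1 _).trans (by simp)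

end

theorem mainTheorem8 (lam : ℕ) (hlam : 1 ≤ lam) (σ : ℝ≥0) (hσ : 0 < σ) (α : ℝ) (hα : 0 ≤ α) :
    -- per-epoch privacy profile of bi-level subsampled training
    (∀ (N L LC LF Lam D : ℕ) (O : Type*)
        (model : EuclideanSpace ℝ (Fin D) → (Fin LC → ℝ) → O) (loss : O → (Fin LF → ℝ) → ℝ)
        (η : ℝ) (C : ℝ≥0) (θ₀ : EuclideanSpace ℝ (Fin D)) (r : ℝ),
        1 ≤ Lam → 0 < C →
        (LC : ℝ) + LF ≤ L - LF + 1 →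
        r = ((LC : ℝ) + LF) / (L - LF + 1) →
        privacyProfile (EventNeighbor (N := N) (L := L) 1)
            (epochMechanism lam Lam model loss η σ C θ₀) α ≤
          hockeyStick α
            (MoG (fun i => -1 * evenMeans lam i) (binomialWeights lam r) σ)
            (MoG (evenMeans lam) (binomialWeights lam r) σ)) ∧
    -- group privacy of sampling with replacement under substitution
    (∀ (A : Type*) [DecidableEq A] (D T k : ℕ)
        (f : Multiset A → EuclideanSpace ℝ (Fin D)) (Δ : ℝ≥0) (r : ℝ),
        1 ≤ T → 0 < Δ → SensitivityBound f Δ →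
        r = (k : ℝ) / T →
        privacyProfile
            (fun x x' : Finset A =>
              x.card = T ∧ x'.card = T ∧ GroupSubstitutionNeighbor k x x')
            (withReplacementMechanism lam f σ Δ) α ≤
          hockeyStick α
            (MoG (fun i => -1 * evenMeans lam i) (binomialWeights lam r) σ)
            (MoG (evenMeans lam) (binomialWeights lam r) σ)) := by
  refine ⟨?_, ?_⟩
  · intro N L LC LF Lam D O model loss η C θ₀ r hLam hC hLr hr
    -- The real inequality forces `LF ≤ L`, so truncated subtraction agrees with subtraction in the
    -- reals.
    have hLF : LF ≤ L := by
      have : (LF : ℝ) < L + 1 := by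
        by_contra h
        have hLC : (0 : ℝ) ≤ LC := Nat.cast_nonneg _
        have hL' : (0 : ℝ) ≤ L := Nat.cast_nonneg _
        linarith
      exact Nat.lt_succ_iff.1 (by exact_mod_cast this)
    have hcast : ((L - LF + 1 : ℕ) : ℝ) = L - LF + 1 := by
      push_cast [hLF]
      ring
    have hL : LC + LF ≤ L - LF + 1 := by
      rw [← hcast] at hLr
      exact_mod_cast hLr
    have hr' : r = ((LC + LF : ℕ) : ℝ) / ((L - LF + 1 : ℕ) : ℝ) := by
      rw [hr, hcast, Nat.cast_add]
    subst hr'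
    refine iSup_le fun x => iSup_le fun x' => iSup_le fun ⟨n, hx, _, t, ht⟩ => ?_
    have hP : IsProbabilityMeasure (epochMechanism lam Lam model loss η σ C θ₀ x') :=
      isProbabilityMeasure_trainingLaw _ _ _ _ _ _ _ _
    refine hockeyStick_le_of_lintegral_le hα fun φ hφ hφ1 => ?_
    refine lintegral_trainingLaw_le lam Lam η θ₀ hL hσ hC α hx (t := t) (fun s hs => ht s ?_) _
      hφ hφ1
    intro h
    exact hs (Fin.ext (by omega))
  · intro A _ D T k f Δ r hT hΔ hf hr
    refine iSup_le fun x => iSup_le fun x' => iSup_le fun ⟨hx, hx', hn⟩ => ?_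
    subst hr
    subst hx
    exact hockeyStick_withReplacementMechanism_le hf hΔ hσ hα lam (Finset.card_pos.1 hT) hx' hn
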